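/- Let $\alpha,\beta,\gamma\in[0,\frac{\pi}{2}]$ with $\alpha+\beta+\gamma<\pi$. Let $S_{\alpha,\beta,\gamma}$ be the triangular surface obtained by gluing two copies of a hyperbolic triangle (curvature $-1$) with angles $\alpha,\beta,\gamma$ along corresponding sides; a vertex with angle $0$ is ideal and gives a cusp, which is not a point of the surface. For $p\in S_{\alpha,\beta,\gamma}$ let $r_p$ be the largest $r\ge 0$ such that the open ball $B_r(p)$ is isometric (as a surface, i.e. for the induced length metrics) to an open disk of radius $r$ in the hyperbolic plane $\mathbb{H}^2$, and let $r(S_{\alpha,\beta,\gamma})=\max_p r_p$ (these maxima exist). Put $$f_{\alpha,\beta,\gamma}(x)=2\cos(\gamma)x^4-(3x^2-1)\left(\sqrt{x^2-\cos^2\alpha}\sqrt{x^2-\cos^2\beta}-\cos\alpha\cos\beta\right)-(x^2-1)\sqrt{4x^2-1}\left(\cos\alpha\sqrt{x^2-\cos^2\beta}+\cos\beta\sqrt{x^2-\cos^2\alpha}\right)$$ and $F_{\alpha,\beta,\gamma}=f_{\alpha,\beta,\gamma}\circ\cosh$. (1) The system $$\sin\frac{\tilde\alpha}{2}=\frac{\cos\alpha}{\cosh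 r},\quad \sin\frac{\tilde\beta}{2}=\frac{\cos\beta}{\cosh r},\quad \cos\vartheta=1-\frac{1}{2\cosh^2 r},\quad \tilde\gamma=2\pi-\tilde\alpha-\tilde\beta-3\vartheta,\quad F_{\alpha,\beta,\gamma}(r)=0$$ has exactly one solution $(r,\tilde\alpha,\tilde\beta,\tilde\gamma,\vartheta)$ with $r>0$, $\tilde\alpha,\tilde\beta,\tilde\gamma\in[0,\pi)$ and $\vartheta\in(0,\frac{\pi}{3})$. (2) $r(S_{\alpha,\beta,\gamma})$ is positive and is the unique zero of $F_{\alpha,\beta,\gamma}$ in $(0,\infty)$, and for every $r\ge 0$ $$F_{\alpha,\beta,\gamma}(r)>0\iff r<r(S_{\alpha,\beta,\gamma}),\qquad F_{\alpha,\beta,\gamma}(r)<0\iff r>r(S_{\alpha,\beta,\gamma}).$$ -/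

import Mathlib

open UpperHalfPlane Topology

noncomputable section

/-! ### The trigonometric system -/

/-- The function `f_{α,β,γ}`. -/
def triF (α β γ x : ℝ) : ℝ :=
  2 * Real.cos γ * x ^ 4
    - (3 * x ^ 2 - 1) *
      (√(x ^ 2 - Real.cos α ^ 2) * √(x ^ 2 - Real.cos β ^ 2) - Real.cos α * Real.cos β)
    - (x ^ 2 - 1) * √(4 * x ^ 2 - 1) *
      (Real.cos α * √(x ^ 2 - Real.cos β ^ 2) + Real.cos β * √(x ^ 2 - Real.cos α ^ 2))

/-- The function `F_{α,β,γ} = f_{α,β,γ} ∘ cosh`. -/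
def triFcosh (α β γ r : ℝ) : ℝ := triF α β γ (Real.cosh r)

/-- The five unknowns of the system. -/
structure TrigUnknowns where
  r : ℝ
  tα : ℝ
  tβ : ℝ
  tγ : ℝ
  ϑ : ℝ

/-- `s` solves the trigonometric system with parameters `α, β, γ`. -/
structure SolvesSystem (α β γ : ℝ) (s : TrigUnknowns) : Prop where
  eqα : Real.sin (s.tα / 2) = Real.cos α / Real.cosh s.r
  eqβ : Real.sin (s.tβ / 2) = Real.cos β / Real.cosh s.r
  eqϑ : Real.cos s.ϑ = 1 - 1 / (2 * Real.cosh s.r ^ 2)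
  eqγ : s.tγ = 2 * Real.pi - s.tα - s.tβ - 3 * s.ϑ
  eqF : triFcosh α β γ s.r = 0

/-- The range that is imposed on the unknowns. -/
structure TrigUnknowns.Admissible (s : TrigUnknowns) : Prop where
  r_pos : 0 < s.r
  tα_mem : s.tα ∈ Set.Ico 0 Real.pi
  tβ_mem : s.tβ ∈ Set.Ico 0 Real.pi
  tγ_mem : s.tγ ∈ Set.Ico 0 Real.pi
  ϑ_mem : s.ϑ ∈ Set.Ioo 0 (Real.pi / 3)

/-! ### Hyperbolic triangles, possibly with ideal vertices

The hyperbolic plane is Mathlib's `ℍ` with its metric of curvature `-1`. -/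

/-- A closed half-plane `{a |z|² + 2 b Re z + c ≥ 0}` of `ℍ`, bounded by the complete geodesic
`a |z|² + 2 b Re z + c = 0`, with the normalisation `b² - a c = 1`. -/
structure HypHalfPlane where
  a : ℝ
  b : ℝ
  c : ℝ
  normalized : b ^ 2 - a * c = 1

namespace HypHalfPlane

def form (H : HypHalfPlane) (z : ℍ) : ℝ :=
  H.a * (z.re ^ 2 + z.im ^ 2) + 2 * H.b * z.re + H.c

/-- The Lorentzian product of the unit normals of two half-planes. If the bounding geodesics meet
in `ℍ`, it is the cosine of the angle between the inner normals at the intersection point, so that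
the intersection of the half-planes has there the interior angle `θ ∈ (0, π)` with
`product = -cos θ`. For half-planes whose intersection is non-empty, the product is `-1` exactly if
either the geodesics share one ideal endpoint and the half-planes intersect in the thin region
between them (interior angle `0` at an ideal vertex), or they are the two sides of one geodesic. -/
def product (H K : HypHalfPlane) : ℝ := H.b * K.b - (H.a * K.c + K.a * H.c) / 2

theorem continuous_form (H : HypHalfPlane) : Continuous H.form := by
  unfold form
  have h1 : Continuous fun z : ℍ => z.re := UpperHalfPlane.continuous_re
  have h2 : Continuous fun z : ℍ => z.im := UpperHalfPlane.continuous_im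
  fun_prop

theorem exists_form_eq_zero (H : HypHalfPlane) : ∃ z : ℍ, H.form z = 0 := by
  obtain ⟨a, b, c, h⟩ := H
  rcases eq_or_ne a 0 with rfl | ha
  · have hb : b ≠ 0 := by rintro rfl; norm_num at h
    refine ⟨⟨⟨-c / (2 * b), 1⟩, by norm_num⟩, ?_⟩
    simp only [form, UpperHalfPlane.re, UpperHalfPlane.im]
    field_simp
    ring
  · refine ⟨⟨⟨-b / a, |1 / a|⟩, by positivity⟩, ?_⟩
    simp only [form, UpperHalfPlane.re, UpperHalfPlane.im, sq_abs]
    field_simp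
    linarith

end HypHalfPlane

/-- A hyperbolic triangle with interior angles `α, β, γ` at its vertices `A, B, C`, a vertex with
angle `0` being ideal: the intersection of three half-planes, where `HA` is bounded by the geodesic
through the side opposite to `A`, and so on.
(For `α, β, γ ∈ [0, π/2]` with `α + β + γ < π` the three normals are linearly independent, and the
non-empty intersection has non-empty interior.) -/
structure HypTriangle (α β γ : ℝ) where
  HA : HypHalfPlane
  HB : HypHalfPlane
  HC : HypHalfPlane
  angleA : HB.product HC = -Real.cos α
  angleB : HC.product HA = -Real.cos β
  angleC : HA.product HB = -Real.cos γ
  nonempty : ∃ z : ℍ, 0 ≤ HA.form z ∧ 0 ≤ HB.form z ∧ 0 ≤ HC.form z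

namespace HypTriangle

variable {α β γ : ℝ}

/-- The closed region of the triangle in `ℍ` (ideal vertices do not belong to it). -/
def carrier (T : HypTriangle α β γ) : Set ℍ :=
  {z | 0 ≤ T.HA.form z ∧ 0 ≤ T.HB.form z ∧ 0 ≤ T.HC.form z}

/-- The union of the three sides. -/
def sides (T : HypTriangle α β γ) : Set ℍ :=
  {z | z ∈ T.carrier ∧ (T.HA.form z = 0 ∨ T.HB.form z = 0 ∨ T.HC.form z = 0)}

theorem sides_nonempty (T : HypTriangle α β γ) : T.sides.Nonempty := by
  obtain ⟨z, hA, hB, hC⟩ := T.nonempty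
  obtain ⟨w, hw⟩ := T.HA.exists_form_eq_zero
  have hc : Continuous fun z => min (T.HA.form z) (min (T.HB.form z) (T.HC.form z)) :=
    T.HA.continuous_form.min (T.HB.continuous_form.min T.HC.continuous_form)
  obtain ⟨p, hp⟩ := mem_range_of_exists_le_of_exists_ge hc (c := 0)
    ⟨w, (min_le_left _ _).trans hw.le⟩ ⟨z, le_min hA (le_min hB hC)⟩
  have h1 : (0 : ℝ) ≤ min (T.HA.form p) (min (T.HB.form p) (T.HC.form p)) := hp.ge
  rw [le_min_iff, le_min_iff] at h1
  refine ⟨p, h1, ?_⟩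
  rcases min_choice (T.HA.form p) (min (T.HB.form p) (T.HC.form p)) with h | h
  · exact Or.inl (h.symm.trans hp)
  · rcases min_choice (T.HB.form p) (T.HC.form p) with h' | h'
    · exact Or.inr (Or.inl ((h.trans h').symm.trans hp))
    · exact Or.inr (Or.inr ((h.trans h').symm.trans hp))

instance (T : HypTriangle α β γ) : Nonempty T.sides := T.sides_nonempty.to_subtype

/-- The inclusion of the sides in the triangle. -/
def sidesIncl (T : HypTriangle α β γ) : T.sides → T.carrier := Set.inclusion fun _ h => h.1

theorem isometry_sidesIncl (T : HypTriangle α β γ) : Isometry T.sidesIncl := fun _ _ => rfl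

/-- The triangular surface `S_{α,β,γ}`: two copies of the triangle, glued along their sides, with
the gluing metric. The distance between points of different copies is the infimum over the points
`s` of the sides of `d(p, s) + d(s, q)`; as the triangle is convex, this is the length metric.
The cusps are not points of the surface. -/
def Surface (T : HypTriangle α β γ) : Type :=
  Metric.GlueSpace T.isometry_sidesIncl T.isometry_sidesIncl

instance (T : HypTriangle α β γ) : MetricSpace T.Surface :=
  inferInstanceAs (MetricSpace (Metric.GlueSpace T.isometry_sidesIncl T.isometry_sidesIncl))

end HypTriangle

/-- Hyperbolic triangles with the angles considered here exist: the half-planes can be taken to be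
`{Re z ≥ 0}`, the outside of the circle with centre `cos γ` and radius `1`, and one more. -/
theorem HypTriangle.exists_of_angles {α β γ : ℝ} (hα : α ∈ Set.Icc 0 (Real.pi / 2))
    (hβ : β ∈ Set.Icc 0 (Real.pi / 2)) (hγ : γ ∈ Set.Icc 0 (Real.pi / 2))
    (hsum : α + β + γ < Real.pi) : Nonempty (HypTriangle α β γ) := by
  obtain ⟨hα0, hα1⟩ := hα
  obtain ⟨hβ0, hβ1⟩ := hβ
  obtain ⟨hγ0, hγ1⟩ := hγ
  have hpi := Real.pi_pos
  have hsα : 0 ≤ Real.sin α := Real.sin_nonneg_of_nonneg_of_le_pi hα0 (by linarith)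
  have hsγ : 0 ≤ Real.sin γ := Real.sin_nonneg_of_nonneg_of_le_pi hγ0 (by linarith)
  have hK : Real.sin α * Real.sin γ < Real.cos β + Real.cos α * Real.cos γ := by
    have h1 : Real.cos (Real.pi - (α + γ)) < Real.cos β :=
      Real.cos_lt_cos_of_nonneg_of_le_pi hβ0 (by linarith) (by linarith)
    rw [Real.cos_pi_sub, Real.cos_add] at h1
    linarith
  set K := Real.cos β + Real.cos α * Real.cos γ with hKdef
  set P := Real.sin α * Real.sin γ with hP
  have hP0 : 0 ≤ P := mul_nonneg hsα hsγ
  have hD : 0 ≤ K ^ 2 - P ^ 2 := by nlinarith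
  have hsq := Real.sq_sqrt hD
  have hs0 := Real.sqrt_nonneg (K ^ 2 - P ^ 2)
  set L := K + √(K ^ 2 - P ^ 2) with hL
  have hLP : P < L := by linarith
  have hL0 : 0 < L := by linarith
  have hLeq : L ^ 2 + P ^ 2 = 2 * K * L := by nlinarith
  clear_value L K P
  have hsα1 := Real.sin_le_one α
  have e1 := Real.sin_sq_add_cos_sq α
  have e2 := Real.sin_sq_add_cos_sq γ
  refine ⟨⟨⟨1, -Real.cos γ, -Real.sin γ ^ 2, by nlinarith⟩, ⟨0, 1, 0, by norm_num⟩,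
    ⟨-(Real.sin α ^ 2 / L), -Real.cos α, L, by field_simp; nlinarith⟩, ?_, ?_, ?_, ?_⟩⟩
  · simp [HypHalfPlane.product]
  · simp only [HypHalfPlane.product]
    have : Real.sin α ^ 2 / L * Real.sin γ ^ 2 = 2 * K - L := by
      rw [div_mul_eq_mul_div, div_eq_iff hL0.ne', ← mul_pow, ← hP]
      linarith
    linarith
  · simp [HypHalfPlane.product]
  · have hy : 0 < Real.sin γ + (L - P) := by linarith
    refine ⟨⟨⟨0, Real.sin γ + (L - P)⟩, hy⟩, ?_, ?_, ?_⟩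
    · simp only [HypHalfPlane.form, UpperHalfPlane.re, UpperHalfPlane.im]
      nlinarith
    · simp [HypHalfPlane.form, UpperHalfPlane.re]
    · simp only [HypHalfPlane.form, UpperHalfPlane.re, UpperHalfPlane.im]
      have h0 : Real.sin α * (L - P) ≤ L - P := mul_le_of_le_one_left (by linarith) hsα1
      have h1 : Real.sin α * (Real.sin γ + (L - P)) ≤ L := by rw [mul_add, ← hP]; linarith
      have h2 : (Real.sin α * (Real.sin γ + (L - P))) ^ 2 ≤ L ^ 2 :=
        pow_le_pow_left₀ (mul_nonneg hsα hy.le) h1 2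
      have h3 : Real.sin α ^ 2 / L * (Real.sin γ + (L - P)) ^ 2 ≤ L := by
        rw [div_mul_eq_mul_div, div_le_iff₀ hL0, ← mul_pow, ← sq]
        exact h2
      linarith

/-! ### The injectivity radius -/

section InjectivityRadius

variable {X : Type*} [MetricSpace X]

/-- The open ball of radius `r` about `p` is isometric, as a surface, to an open disk of radius `r`
of the hyperbolic plane: there is a homeomorphism between them that preserves distances locally
(equivalently, lengths of curves). The ambient distance of two points of an embedded disk may be
realised outside the disk, which is why distances are compared locally. -/
def IsEmbeddedDisk (p : X) (r : ℝ) : Prop :=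
  ∃ z : ℍ, ∃ e : Metric.ball p r ≃ₜ Metric.ball z r,
    ∀ x, ∃ U ∈ 𝓝 x, ∀ y ∈ U, ∀ y' ∈ U, dist (e y) (e y') = dist y y'

/-- The radii of the embedded disks centred at `p`. -/
def embeddedRadii (p : X) : Set ℝ := {r | 0 ≤ r ∧ IsEmbeddedDisk p r}

/-- The injectivity radius at `p`. -/
def injRadius (p : X) : ℝ := sSup (embeddedRadii p)

variable (X) in
/-- The maximum injectivity radius. -/
def maxInjRadius : ℝ := ⨆ p : X, injRadius p

end InjectivityRadius

end

/-! Let `P_i` be the mirror image of a point `p` of the triangle in side `i`. As no angle is obtuse,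
the distance between `p` on one sheet and `q` on the other is the least of the three `dist P_i q`
(`Nonobtuse.dist_emb_not_le`, `Nonobtuse.exists_dist_emb_not`). The injectivity radius at `p` is
then half the least distance between two of the `P_i` (`Nonobtuse.exists_injRadius`). If all these
distances are at least `2r`, the ball unfolds into the plane by reflecting what lies beyond a side
(`Nonobtuse.isEmbeddedDisk_emb`). If some `dist P_i P_j` is less than `2r`, the geodesic from `P_i`
to `P_j` cuts the triangle in a segment joining two sides. Its copies in the two sheets are two
shortest paths with common ends inside the ball, which a hyperbolic disk does not allow
(`IsEmbeddedDisk.midpoint_unique`).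

The maximum is attained at a point `o` where the three distances agree. In the hyperboloid model the
heights over the sides are products with the unit normals. The adjugate of the Gram matrix of the
normals, applied to the heights of a point of the triangle, has nonnegative entries that increase
with the distances between the mirror images. If all distances at `p` exceeded those at `o`, pairing
with the heights of `p` would make the product of `o` and `p` less than `1`, which is impossible
(`exists_dist_refl_le`).

Let `x = cosh r`. Three loops of length `2r` at `o` cut the surface into an equilateral triangle and
three pieces with one vertex each, and the angles at `o` add up to `2π`, that is, `halfAngle = π`.
Conversely, this equation yields explicit heights for `o`, proportional to the sines of three angles
with sum `π` (`exists_heights`). Finally `triF` is `2x⁵ (sin c - sin s)` with `0 ≤ c < s` and `s + c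
= halfAngle` (`triF_eq`), so its sign compares `halfAngle` with `π`; and `halfAngle` decreases
strictly in `x`. -/

/-! ### The hyperboloid model -/

/-- The Lorentzian bilinear form of signature `(1, 2)` on `ℝ³`. -/
noncomputable def lor (v w : ℝ × ℝ × ℝ) : ℝ := (v.1 * w.2.2 + w.1 * v.2.2) / 2 - v.2.1 * w.2.1

theorem lor_comm (v w : ℝ × ℝ × ℝ) : lor v w = lor w v := by unfold lor; ring

theorem lor_add_left (u v w : ℝ × ℝ × ℝ) : lor (u + v) w = lor u w + lor v w := by
  simp only [lor, Prod.fst_add, Prod.snd_add]; ring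

theorem lor_smul_left (a : ℝ) (v w : ℝ × ℝ × ℝ) : lor (a • v) w = a * lor v w := by
  simp only [lor, Prod.smul_fst, Prod.smul_snd, smul_eq_mul]; ring

theorem lor_add_right (u v w : ℝ × ℝ × ℝ) : lor u (v + w) = lor u v + lor u w := by
  simp only [lor, Prod.fst_add, Prod.snd_add]; ring

theorem lor_smul_right (a : ℝ) (v w : ℝ × ℝ × ℝ) : lor v (a • w) = a * lor v w := by
  simp only [lor, Prod.smul_fst, Prod.smul_snd, smul_eq_mul]; ring

theorem lor_sub_left (u v w : ℝ × ℝ × ℝ) : lor (u - v) w = lor u w - lor v w := by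
  simp only [lor, Prod.fst_sub, Prod.snd_sub]; ring

theorem lor_sub_right (u v w : ℝ × ℝ × ℝ) : lor u (v - w) = lor u v - lor u w := by
  simp only [lor, Prod.fst_sub, Prod.snd_sub]; ring

/-- The point of the hyperboloid that corresponds to a point of the upper half-plane. -/
noncomputable def vec (z : ℍ) : ℝ × ℝ × ℝ := ((z.re ^ 2 + z.im ^ 2) / z.im, z.re / z.im, 1 / z.im)

theorem lor_vec_self (z : ℍ) : lor (vec z) (vec z) = 1 := by
  have := z.im_pos.ne'
  simp only [lor, vec]; field_simp; ring

theorem cosh_dist_eq_lor (z w : ℍ) : Real.cosh (dist z w) = lor (vec z) (vec w) := by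
  have h1 := z.im_pos.ne'
  have h2 := w.im_pos.ne'
  rw [UpperHalfPlane.cosh_dist, Complex.dist_eq, Complex.sq_norm, Complex.normSq_apply]
  simp only [lor, vec, Complex.sub_re, Complex.sub_im, UpperHalfPlane.coe_re,
    UpperHalfPlane.coe_im]
  field_simp
  ring

theorem one_le_lor_vec (z w : ℍ) : 1 ≤ lor (vec z) (vec w) := by
  rw [← cosh_dist_eq_lor]; exact Real.one_le_cosh _

theorem dist_le_dist_iff_lor {z w z' w' : ℍ} :
    dist z w ≤ dist z' w' ↔ lor (vec z) (vec w) ≤ lor (vec z') (vec w') := by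
  rw [← cosh_dist_eq_lor, ← cosh_dist_eq_lor, Real.cosh_le_cosh, abs_of_nonneg dist_nonneg,
    abs_of_nonneg dist_nonneg]

theorem dist_eq_dist_of_lor {z w z' w' : ℍ} (h : lor (vec z) (vec w) = lor (vec z') (vec w')) :
    dist z w = dist z' w' :=
  le_antisymm (dist_le_dist_iff_lor.2 h.le) (dist_le_dist_iff_lor.2 h.ge)

theorem dist_lt_iff_lor {z w : ℍ} {r : ℝ} (hr : 0 ≤ r) :
    dist z w < r ↔ lor (vec z) (vec w) < Real.cosh r := by
  rw [← cosh_dist_eq_lor, Real.cosh_lt_cosh, abs_of_nonneg dist_nonneg, abs_of_nonneg hr]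

theorem vec_injective : Function.Injective vec := by
  intro z w h
  have h1 := dist_eq_dist_of_lor (z := z) (w := w) (z' := z) (w' := z) (by rw [h])
  rwa [dist_self, dist_eq_zero] at h1

/-- By the reversed Cauchy–Schwarz inequality, unit vectors on different sheets of the hyperboloid
have negative product, so a positive product with one point of the upper sheet selects that sheet.
-/
theorem exists_vec_eq {v : ℝ × ℝ × ℝ} (hv : lor v v = 1) {z : ℍ} (hz : 0 < lor v (vec z)) :
    ∃ w : ℍ, vec w = v := by
  obtain ⟨X, Y, Z⟩ := v
  have hz1 := lor_vec_self z
  have hZ0 : 0 < (vec z).2.2 := by simp only [vec]; have := z.im_pos; positivity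
  generalize vec z = u at *
  obtain ⟨A, B, C⟩ := u
  simp only [lor] at *
  have hXZ : X * Z = 1 + Y ^ 2 := by linarith
  have hAC : A * C = 1 + B ^ 2 := by linarith
  have hZ : 0 < Z := by
    by_contra hneg
    have hZ' : Z < 0 := lt_of_le_of_ne (not_lt.1 hneg) (by rintro rfl; nlinarith [sq_nonneg Y])
    have hX' : X < 0 := by nlinarith [sq_nonneg Y]
    have hA : 0 < A := by nlinarith [sq_nonneg B]
    have h1 : (2 * (Y * B)) ^ 2 < (X * C + A * Z) ^ 2 := by
      have : (2 * (Y * B)) ^ 2 < 4 * ((X * Z) * (A * C)) := by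
        rw [hXZ, hAC]; nlinarith [sq_nonneg Y, sq_nonneg B]
      nlinarith [sq_nonneg (X * C - A * Z)]
    have h2 := sq_lt_sq.1 h1
    have h3 : X * C + A * Z < 0 := by nlinarith
    rw [abs_of_neg h3] at h2
    have := neg_abs_le (2 * (Y * B))
    linarith
  refine ⟨⟨⟨Y / Z, 1 / Z⟩, by positivity⟩, ?_⟩
  simp only [vec, UpperHalfPlane.re, UpperHalfPlane.im, Prod.mk.injEq]
  refine ⟨?_, ?_, ?_⟩
  · field_simp; linarith
  · field_simp
  · field_simp

/-! ### Half-planes and reflections -/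

namespace HypHalfPlane

/-- The unit normal of a half-plane. -/
def normal (H : HypHalfPlane) : ℝ × ℝ × ℝ := (H.c, -H.b, H.a)

/-- The hyperbolic sine of the signed distance to the boundary of a half-plane. -/
noncomputable def ht (H : HypHalfPlane) (z : ℍ) : ℝ := lor (vec z) H.normal

theorem lor_normal (H K : HypHalfPlane) : lor H.normal K.normal = -H.product K := by
  simp only [lor, normal, product]; ring

theorem lor_normal_self (H : HypHalfPlane) : lor H.normal H.normal = -1 := by
  have := H.normalized
  simp only [lor, normal]; linarith

theorem form_eq (H : HypHalfPlane) (z : ℍ) : H.form z = 2 * z.im * H.ht z := by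
  have := z.im_pos.ne'
  simp only [form, ht, lor, vec, normal]; field_simp; ring

theorem form_nonneg_iff (H : HypHalfPlane) (z : ℍ) : 0 ≤ H.form z ↔ 0 ≤ H.ht z := by
  rw [form_eq, mul_nonneg_iff_of_pos_left (by have := z.im_pos; positivity)]

theorem form_eq_zero_iff (H : HypHalfPlane) (z : ℍ) : H.form z = 0 ↔ H.ht z = 0 := by
  have := z.im_pos.ne'
  rw [form_eq]; simp [this]

theorem continuous_ht (H : HypHalfPlane) : Continuous H.ht := by
  have : H.ht = fun z => H.form z / (2 * z.im) := by
    ext z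
    have := z.im_pos.ne'
    rw [form_eq]; field_simp
  rw [this]
  exact H.continuous_form.div (continuous_const.mul UpperHalfPlane.continuous_im)
    fun z => by have := z.im_pos; positivity

theorem exists_refl (H : HypHalfPlane) (z : ℍ) :
    ∃ w : ℍ, vec w = vec z + (2 * H.ht z) • H.normal := by
  have h : lor (vec z) H.normal = H.ht z := rfl
  apply exists_vec_eq (z := z)
  · simp only [lor_add_left, lor_add_right, lor_smul_left, lor_smul_right, lor_normal_self,
      lor_vec_self, lor_comm H.normal (vec z), h]
    ring
  · simp only [lor_add_left, lor_smul_left, lor_vec_self, lor_comm H.normal (vec z), h]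
    nlinarith [sq_nonneg (H.ht z)]

/-- The reflection in the boundary of a half-plane. -/
noncomputable def refl (H : HypHalfPlane) (z : ℍ) : ℍ := (H.exists_refl z).choose

theorem vec_refl (H : HypHalfPlane) (z : ℍ) :
    vec (H.refl z) = vec z + (2 * H.ht z) • H.normal := (H.exists_refl z).choose_spec

theorem ht_refl (H K : HypHalfPlane) (z : ℍ) :
    H.ht (K.refl z) = H.ht z - 2 * K.ht z * H.product K := by
  simp only [ht, vec_refl, lor_add_left, lor_smul_left]
  rw [lor_comm K.normal, lor_normal]; ring

theorem ht_refl_self (H : HypHalfPlane) (z : ℍ) : H.ht (H.refl z) = -H.ht z := by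
  have : H.product H = 1 := by have := H.normalized; simp only [product]; linarith
  rw [ht_refl, this]; ring

theorem refl_refl (H : HypHalfPlane) (z : ℍ) : H.refl (H.refl z) = z := by
  apply vec_injective
  rw [vec_refl, ht_refl_self, vec_refl, add_assoc, ← add_smul]
  ring_nf; simp

theorem refl_of_ht_eq_zero (H : HypHalfPlane) {z : ℍ} (hz : H.ht z = 0) : H.refl z = z := by
  apply vec_injective
  rw [vec_refl, hz]; simp

theorem ht_eq_zero_of_refl_eq (H : HypHalfPlane) {z : ℍ} (hz : H.refl z = z) : H.ht z = 0 := by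
  have := H.ht_refl_self z
  rw [hz] at this; linarith

theorem isometry_refl (H : HypHalfPlane) : Isometry H.refl := by
  refine Isometry.of_dist_eq fun z w => dist_eq_dist_of_lor ?_
  simp only [vec_refl, lor_add_left, lor_add_right, lor_smul_left, lor_smul_right,
    lor_normal_self, lor_comm H.normal (vec _)]
  simp only [ht]; ring

theorem dist_refl_refl (H : HypHalfPlane) (z w : ℍ) :
    dist (H.refl z) (H.refl w) = dist z w := H.isometry_refl.dist_eq z w

theorem dist_refl_left (H : HypHalfPlane) (z w : ℍ) :
    dist (H.refl z) w = dist z (H.refl w) := by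
  rw [← H.dist_refl_refl z, refl_refl]

theorem lor_refl (H : HypHalfPlane) (z w : ℍ) :
    lor (vec (H.refl z)) (vec w) = lor (vec z) (vec w) + 2 * (H.ht z * H.ht w) := by
  simp only [vec_refl, lor_add_left, lor_smul_left, lor_comm H.normal (vec _)]
  simp only [ht]; ring

/-- A point on the other side of the boundary is closer to the mirror image. -/
theorem dist_refl_le (H : HypHalfPlane) {z w : ℍ} (h : H.ht z * H.ht w ≤ 0) :
    dist (H.refl z) w ≤ dist z w := by
  rw [dist_le_dist_iff_lor, lor_refl]; linarith

/-- This turns the distances between mirror images, which govern the injectivity radius, into a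
quadratic form in the heights. -/
theorem sinh_half_dist_refl_sq (H K : HypHalfPlane) (z : ℍ) :
    Real.sinh (dist (H.refl z) (K.refl z) / 2) ^ 2 =
      H.ht z ^ 2 + K.ht z ^ 2 - 2 * H.ht z * K.ht z * H.product K := by
  have h1 := cosh_dist_eq_lor (H.refl z) (K.refl z)
  have h2 := Real.cosh_two_mul (dist (H.refl z) (K.refl z) / 2)
  rw [mul_div_cancel₀ _ two_ne_zero, h1, Real.cosh_sq] at h2
  have h3 : K.ht (H.refl z) = K.ht z - 2 * H.ht z * H.product K := by
    rw [ht_refl]; simp only [product]; ring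
  rw [lor_comm, lor_refl, lor_comm, h3, lor_refl, lor_vec_self] at h2
  linarith

end HypHalfPlane

/-! ### Geodesics -/

/-- `c` is a complete geodesic, parametrised by arc length. -/
def IsLine (c : ℝ → ℍ) : Prop :=
  ∃ v w : ℝ × ℝ × ℝ, lor v v = 1 ∧ lor v w = 0 ∧ lor w w = -1 ∧
    ∀ t, vec (c t) = Real.cosh t • v + Real.sinh t • w

theorem exists_isLine_of_tangent {z : ℍ} {w : ℝ × ℝ × ℝ} (h0 : lor (vec z) w = 0)
    (h1 : lor w w = -1) :
    ∃ c, IsLine c ∧ ∀ t, vec (c t) = Real.cosh t • vec z + Real.sinh t • w := by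
  have h : ∀ t : ℝ, ∃ p : ℍ, vec p = Real.cosh t • vec z + Real.sinh t • w := by
    intro t
    apply exists_vec_eq (z := z)
    · simp only [lor_add_left, lor_add_right, lor_smul_left, lor_smul_right, lor_vec_self,
        lor_comm w (vec z), h0, h1]
      linarith [Real.cosh_sq t]
    · simp only [lor_add_left, lor_smul_left, lor_vec_self, lor_comm w (vec z), h0]
      have := Real.cosh_pos t
      linarith
  choose c hc using h
  exact ⟨c, ⟨_, _, lor_vec_self z, h0, h1, hc⟩, hc⟩

theorem exists_isLine (P Q : ℍ) : ∃ c, IsLine c ∧ c 0 = P ∧ c (dist P Q) = Q := by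
  rcases eq_or_ne P Q with rfl | hne
  -- The vertical unit tangent vector at `P`; any direction would do here.
  · obtain ⟨c, hc, hc'⟩ := exists_isLine_of_tangent (z := P)
      (w := ((P.im ^ 2 - P.re ^ 2) / P.im, -P.re / P.im, -1 / P.im))
      (by have := P.im_pos.ne'; simp only [lor, vec]; field_simp; ring)
      (by have := P.im_pos.ne'; simp only [lor]; field_simp; ring)
    have h0 : c 0 = P := vec_injective (by rw [hc']; simp)
    exact ⟨c, hc, h0, by rwa [dist_self]⟩
  · have hL : 0 < dist P Q := dist_pos.2 hne
    have hs : 0 < Real.sinh (dist P Q) := Real.sinh_pos_iff.2 hL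
    have hch := Real.cosh_sq (dist P Q)
    have hPQ := (cosh_dist_eq_lor P Q).symm
    -- The tangent vector is the normalised component of `vec Q` orthogonal to `vec P`.
    obtain ⟨c, hc, hc'⟩ := exists_isLine_of_tangent (z := P)
      (w := (1 / Real.sinh (dist P Q)) • (vec Q - Real.cosh (dist P Q) • vec P))
      (by simp only [lor_smul_right, lor_sub_right, lor_vec_self, hPQ]; ring)
      (by
        simp only [lor_smul_right, lor_smul_left, lor_sub_right, lor_sub_left, lor_vec_self,
          lor_comm (vec Q) (vec P), hPQ]
        field_simp
        linarith)
    refine ⟨c, hc, vec_injective (by rw [hc']; simp), vec_injective ?_⟩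
    rw [hc', smul_smul, mul_one_div_cancel hs.ne', one_smul, add_sub_cancel]

namespace IsLine

variable {c : ℝ → ℍ}

theorem isometry (hc : IsLine c) : Isometry c := by
  obtain ⟨v, w, hv, hvw, hw, h⟩ := hc
  refine Isometry.of_dist_eq fun s t => ?_
  have h1 : Real.cosh (dist (c s) (c t)) = Real.cosh (dist s t) := by
    rw [cosh_dist_eq_lor, h, h, Real.dist_eq, Real.cosh_abs, Real.cosh_sub]
    simp only [lor_add_left, lor_add_right, lor_smul_left, lor_smul_right, lor_comm w v, hv, hvw,
      hw]
    ring
  have h2 := congrArg Real.arcosh h1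
  rwa [Real.arcosh_cosh dist_nonneg, Real.arcosh_cosh dist_nonneg] at h2

theorem dist_eq (hc : IsLine c) {s t : ℝ} (h : s ≤ t) : dist (c s) (c t) = t - s := by
  rw [hc.isometry.dist_eq, dist_comm, Real.dist_eq, abs_of_nonneg (by linarith)]

/-- Along a geodesic every linear functional is a combination of `cosh` and `sinh`. This
interpolation formula plays the role of affine interpolation and yields the convexity of half-planes
and of balls. -/
theorem lor_eq (hc : IsLine c) (n : ℝ × ℝ × ℝ) (s t u : ℝ) :
    Real.sinh (u - s) * lor (vec (c t)) n =
      Real.sinh (u - t) * lor (vec (c s)) n + Real.sinh (t - s) * lor (vec (c u)) n := by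
  obtain ⟨v, w, hv, hvw, hw, h⟩ := hc
  simp only [h, lor_add_left, lor_smul_left, Real.sinh_sub]
  ring

theorem lor_nonneg (hc : IsLine c) {n : ℝ × ℝ × ℝ} {s t u : ℝ} (hst : s ≤ t) (htu : t ≤ u)
    (hs : 0 ≤ lor (vec (c s)) n) (hu : 0 ≤ lor (vec (c u)) n) : 0 ≤ lor (vec (c t)) n := by
  rcases (hst.trans htu).eq_or_lt with rfl | h
  · rwa [le_antisymm htu hst]
  · have h1 := hc.lor_eq n s t u
    have h2 : 0 < Real.sinh (u - s) := Real.sinh_pos_iff.2 (by linarith)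
    have h3 : 0 ≤ Real.sinh (u - t) := Real.sinh_nonneg_iff.2 (by linarith)
    have h4 : 0 ≤ Real.sinh (t - s) := Real.sinh_nonneg_iff.2 (by linarith)
    refine nonneg_of_mul_nonneg_right ?_ h2
    rw [h1]; positivity

theorem lor_pos (hc : IsLine c) {n : ℝ × ℝ × ℝ} {s t u : ℝ} (hst : s < t) (htu : t < u)
    (hs : 0 ≤ lor (vec (c s)) n) (hu : 0 ≤ lor (vec (c u)) n)
    (hsu : 0 < lor (vec (c s)) n + lor (vec (c u)) n) : 0 < lor (vec (c t)) n := by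
  have h1 := hc.lor_eq n s t u
  have h2 : 0 < Real.sinh (u - s) := Real.sinh_pos_iff.2 (by linarith)
  have h3 : 0 < Real.sinh (u - t) := Real.sinh_pos_iff.2 (by linarith)
  have h4 : 0 < Real.sinh (t - s) := Real.sinh_pos_iff.2 (by linarith)
  refine pos_of_mul_pos_right ?_ h2.le
  rw [h1]
  rcases hs.eq_or_lt with h | h
  · rw [← h] at hsu ⊢
    have : 0 < lor (vec (c u)) n := by linarith
    rw [mul_zero, zero_add]; positivity
  · have := mul_pos h3 h
    have := mul_nonneg h4.le hu
    linarith

theorem ht_nonneg (hc : IsLine c) {H : HypHalfPlane} {s t u : ℝ} (hst : s ≤ t) (htu : t ≤ u)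
    (hs : 0 ≤ H.ht (c s)) (hu : 0 ≤ H.ht (c u)) : 0 ≤ H.ht (c t) :=
  hc.lor_nonneg hst htu hs hu

theorem ht_pos (hc : IsLine c) {H : HypHalfPlane} {s t u : ℝ} (hst : s < t) (htu : t < u)
    (hs : 0 ≤ H.ht (c s)) (hu : 0 ≤ H.ht (c u)) (hsu : 0 < H.ht (c s) + H.ht (c u)) :
    0 < H.ht (c t) :=
  hc.lor_pos hst htu hs hu hsu

theorem exists_ht_eq_zero (hc : IsLine c) {H : HypHalfPlane} {s u : ℝ} (hsu : s ≤ u)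
    (hs : H.ht (c s) ≤ 0) (hu : 0 ≤ H.ht (c u)) : ∃ t ∈ Set.Icc s u, H.ht (c t) = 0 :=
  intermediate_value_Icc hsu (H.continuous_ht.comp hc.isometry.continuous).continuousOn
    ⟨hs, hu⟩

theorem _root_.sinh_add_sinh_le {a b : ℝ} (ha : 0 ≤ a) (hb : 0 ≤ b) :
    Real.sinh a + Real.sinh b ≤ Real.sinh (a + b) := by
  rw [Real.sinh_add]
  have h1 := Real.sinh_nonneg_iff.2 ha
  have h2 := Real.sinh_nonneg_iff.2 hb
  nlinarith [Real.one_le_cosh a, Real.one_le_cosh b]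

/-- Balls are convex. -/
theorem dist_lt (hc : IsLine c) {z : ℍ} {r s t u : ℝ} (hst : s ≤ t) (htu : t ≤ u)
    (hs : dist z (c s) < r) (hu : dist z (c u) < r) : dist z (c t) < r := by
  rcases (hst.trans htu).eq_or_lt with rfl | h
  · rwa [le_antisymm htu hst]
  · have hr : 0 ≤ r := dist_nonneg.trans hs.le
    rw [dist_lt_iff_lor hr, lor_comm] at *
    have h1 := hc.lor_eq (vec z) s t u
    have h2 : 0 < Real.sinh (u - s) := Real.sinh_pos_iff.2 (by linarith)
    have h3 : 0 ≤ Real.sinh (u - t) := Real.sinh_nonneg_iff.2 (by linarith)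
    have h4 : 0 ≤ Real.sinh (t - s) := Real.sinh_nonneg_iff.2 (by linarith)
    -- The two interpolation weights add up to at most `sinh (u - s)`, so a positive common bound
    -- `M` at the ends persists in between.
    have h5 := sinh_add_sinh_le (a := u - t) (b := t - s) (by linarith) (by linarith)
    rw [sub_add_sub_cancel] at h5
    obtain ⟨M, hM1, hM2⟩ : ∃ M, max (lor (vec (c s)) (vec z)) (lor (vec (c u)) (vec z)) ≤ M ∧
        M < Real.cosh r := ⟨_, le_rfl, max_lt hs hu⟩
    rw [max_le_iff] at hM1
    refine lt_of_le_of_lt ?_ hM2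
    have hM0 : 0 < M := by linarith [one_le_lor_vec (c s) z]
    refine le_of_mul_le_mul_left ?_ h2
    rw [h1]
    nlinarith

end IsLine

/-- A point that is at most as far from two points as a midpoint would be is their midpoint. -/
theorem eq_of_dist_le_half {P Q M N : ℍ} {l : ℝ} (h : 2 * l ≤ dist P Q)
    (hMP : dist M P ≤ l) (hMQ : dist M Q ≤ l) (hNP : dist N P ≤ l) (hNQ : dist N Q ≤ l) :
    M = N := by
  have hl : 0 ≤ l := dist_nonneg.trans hMP
  -- In the hyperboloid the midpoint is the normalised sum of the ends, a description that does not
  -- mention `K`.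
  have key : ∀ K : ℍ, dist K P ≤ l → dist K Q ≤ l →
      Real.cosh l • vec K = (1 / 2 : ℝ) • (vec P + vec Q) := by
    intro K hP hQ
    obtain ⟨c, hc, h0, h1⟩ := exists_isLine P Q
    have hPQ : dist P Q = 2 * l := by
      linarith [dist_triangle P K Q, dist_comm K P]
    rw [hPQ] at h1
    have hm := fun n => hc.lor_eq n 0 l (2 * l)
    rw [h0, h1, show 2 * l - l = l by ring, sub_zero, sub_zero, Real.sinh_two_mul] at hm
    rcases hl.eq_or_lt with rfl | hl'
    · have e1 : K = P := dist_le_zero.1 hP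
      have e2 : K = Q := dist_le_zero.1 hQ
      rw [← e1, ← e2, ← two_smul ℝ, smul_smul]; simp
    have hs : 0 < Real.sinh l := Real.sinh_pos_iff.2 hl'
    have hm' : ∀ n, 2 * Real.cosh l * lor (vec (c l)) n = lor (vec P) n + lor (vec Q) n := by
      intro n
      have := hm n
      refine mul_left_cancel₀ hs.ne' ?_
      linarith
    have hKc : K = c l := by
      have h2 : lor (vec P) (vec K) ≤ Real.cosh l := by
        rw [← cosh_dist_eq_lor, dist_comm, Real.cosh_le_cosh, abs_of_nonneg dist_nonneg,
          abs_of_nonneg hl]; exact hP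
      have h3 : lor (vec Q) (vec K) ≤ Real.cosh l := by
        rw [← cosh_dist_eq_lor, dist_comm, Real.cosh_le_cosh, abs_of_nonneg dist_nonneg,
          abs_of_nonneg hl]; exact hQ
      have h4 := hm' (vec K)
      -- The product of two points is at least `1`, with equality only if they coincide.
      have h5 : lor (vec (c l)) (vec K) ≤ 1 := by
        have := Real.cosh_pos l
        nlinarith
      rw [← cosh_dist_eq_lor] at h5
      by_contra hne
      exact absurd (Real.one_lt_cosh.2 (dist_ne_zero.2 (Ne.symm hne))) h5.not_gt
    have e1 := hm' (1, 0, 0)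
    have e2 := hm' (0, 1, 0)
    have e3 := hm' (0, 0, 1)
    rw [hKc]
    simp only [lor] at e1 e2 e3
    ext <;> simp only [Prod.smul_fst, Prod.smul_snd, Prod.fst_add, Prod.snd_add, smul_eq_mul] <;>
      linarith
  have h1 := (key M hMP hMQ).trans (key N hNP hNQ).symm
  exact vec_injective (smul_right_injective _ (Real.cosh_pos l).ne' h1)

/-! ### Embedded disks -/

/-- A path which is locally `1`-Lipschitz is `1`-Lipschitz. -/
theorem dist_le_of_locally {X : Type*} [PseudoMetricSpace X] {f : ℝ → X} {a b : ℝ} (hab : a ≤ b)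
    (h : ∀ t ∈ Set.Icc a b, ∀ᶠ s in 𝓝[Set.Icc a b] t, dist (f s) (f t) ≤ |s - t|) :
    dist (f a) (f b) ≤ b - a := by
  have hcont : ContinuousOn f (Set.Icc a b) := by
    intro t ht
    refine tendsto_iff_dist_tendsto_zero.2 (squeeze_zero' (.of_forall fun _ => dist_nonneg)
      (h t ht) ?_)
    have : Filter.Tendsto (fun s : ℝ => |s - t|) (𝓝 t) (𝓝 |t - t|) :=
      ((continuous_id.sub continuous_const).abs).tendsto t
    rw [sub_self, abs_zero] at this
    exact this.mono_left nhdsWithin_le_nhds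
  -- Continuous induction: the good times form a closed set, and the local bound pushes any good
  -- time to a slightly later one.
  have hclosed : IsClosed ({t | dist (f a) (f t) ≤ t - a} ∩ Set.Icc a b) := by
    have h1 : ContinuousOn (fun t => dist (f a) (f t) - (t - a)) (Set.Icc a b) := by fun_prop
    have h2 := h1.preimage_isClosed_of_isClosed isClosed_Icc (isClosed_Iic (a := (0 : ℝ)))
    convert! h2 using 1
    ext t
    simp [and_comm]
  have key := hclosed.Icc_subset_of_forall_exists_gt (by simp) ?_ (Set.right_mem_Icc.2 hab)
  · exact key
  · rintro t ⟨ht1, ht2⟩ y hy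
    have h1 := h t ⟨ht2.1, ht2.2.le⟩
    have h2 : 𝓝[Set.Ioc t (min y b)] t ≤ 𝓝[Set.Icc a b] t :=
      nhdsWithin_mono _ fun s hs => ⟨ht2.1.trans hs.1.le, hs.2.trans (min_le_right _ _)⟩
    have hy' : t < min y b := lt_min hy ht2.2
    have : (𝓝[Set.Ioc t (min y b)] t).NeBot := by
      rw [nhdsWithin_Ioc_eq_nhdsGT hy']; infer_instance
    obtain ⟨s, hs, hs'⟩ := ((h1.filter_mono h2).and self_mem_nhdsWithin).exists
    refine ⟨s, ?_, hs'.1, hs'.2.trans (min_le_left _ _)⟩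
    have h3 := dist_triangle (f a) (f t) (f s)
    rw [dist_comm (f t)] at h3
    rw [abs_of_pos (by linarith [hs'.1])] at hs
    simp only [Set.mem_ofPred_eq] at ht1 ⊢
    linarith

section EmbeddedDisk

variable {X : Type*} [MetricSpace X]

/-- An embedded disk is parametrised by mutually inverse local isometries. -/
theorem IsEmbeddedDisk.exists_maps {p : X} {r : ℝ} (h : IsEmbeddedDisk p r) :
    ∃ z : ℍ, ∃ E : X → ℍ, ∃ F : ℍ → X,
      (∀ x ∈ Metric.ball p r, E x ∈ Metric.ball z r ∧ F (E x) = x) ∧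
      (∀ x ∈ Metric.ball p r, ∃ U ∈ 𝓝 x, ∀ y ∈ U, ∀ y' ∈ U, dist (E y) (E y') = dist y y') ∧
      (∀ w ∈ Metric.ball z r, ∃ U ∈ 𝓝 w, ∀ y ∈ U, ∀ y' ∈ U, dist (F y) (F y') = dist y y') := by
  classical
  obtain ⟨z, e, he⟩ := h
  let E : X → ℍ := fun x => if hx : x ∈ Metric.ball p r then e ⟨x, hx⟩ else z
  let F : ℍ → X := fun w => if hw : w ∈ Metric.ball z r then e.symm ⟨w, hw⟩ else p
  have hE : ∀ x (hx : x ∈ Metric.ball p r), E x = e ⟨x, hx⟩ := fun x hx => dif_pos hx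
  have hF : ∀ w (hw : w ∈ Metric.ball z r), F w = e.symm ⟨w, hw⟩ := fun w hw => dif_pos hw
  refine ⟨z, E, F, fun x hx => ?_, fun x hx => ?_, fun w hw => ?_⟩
  · rw [hE x hx]
    refine ⟨(e ⟨x, hx⟩).2, ?_⟩
    rw [hF _ (e ⟨x, hx⟩).2, Subtype.coe_eta, e.symm_apply_apply]
  · obtain ⟨U, hU, hU'⟩ := he ⟨x, hx⟩
    refine ⟨Subtype.val '' U, ?_, ?_⟩
    · exact Metric.isOpen_ball.isOpenEmbedding_subtypeVal.image_mem_nhds.2 hU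
    · rintro _ ⟨y, hy, rfl⟩ _ ⟨y', hy', rfl⟩
      rw [hE _ y.2, hE _ y'.2]
      exact hU' y hy y' hy'
  · obtain ⟨U, hU, hU'⟩ := he (e.symm ⟨w, hw⟩)
    refine ⟨Subtype.val '' (e '' U), ?_, ?_⟩
    · have := e.isOpenEmbedding.image_mem_nhds.2 hU
      rw [e.apply_symm_apply] at this
      exact Metric.isOpen_ball.isOpenEmbedding_subtypeVal.image_mem_nhds.2 this
    · rintro _ ⟨_, ⟨y, hy, rfl⟩, rfl⟩ _ ⟨_, ⟨y', hy', rfl⟩, rfl⟩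
      rw [hF _ (e y).2, hF _ (e y').2, Subtype.coe_eta, Subtype.coe_eta, e.symm_apply_apply,
        e.symm_apply_apply]
      exact (hU' y hy y' hy').symm

theorem dist_comp_le_of_locally_isometric {Y : Type*} [MetricSpace Y] {E : X → Y} {s : Set X}
    (hE : ∀ x ∈ s, ∃ U ∈ 𝓝 x, ∀ y ∈ U, ∀ y' ∈ U, dist (E y) (E y') = dist y y') {c : ℝ → X}
    {a b : ℝ} (hab : a ≤ b) (hc : ∀ t ∈ Set.Icc a b, ∀ u ∈ Set.Icc a b, dist (c t) (c u) ≤ |t - u|)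
    (hcs : ∀ t ∈ Set.Icc a b, c t ∈ s) : dist (E (c a)) (E (c b)) ≤ b - a := by
  refine dist_le_of_locally (f := E ∘ c) hab fun u hu => ?_
  obtain ⟨U, hU, hU'⟩ := hE _ (hcs u hu)
  obtain ⟨ε, hε, hεU⟩ := Metric.mem_nhds_iff.1 hU
  filter_upwards [self_mem_nhdsWithin, mem_nhdsWithin_of_mem_nhds (Metric.ball_mem_nhds u hε)]
    with v hv hv'
  have h2 := hc v hv u hu
  exact (hU' _ (hεU (h2.trans_lt hv')) _ (mem_of_mem_nhds hU)).trans_le h2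

/-- In an embedded disk, two shortest paths with the same endpoints have the same midpoint. -/
theorem IsEmbeddedDisk.midpoint_unique {p : X} {r : ℝ} (h : IsEmbeddedDisk p r) {l : ℝ}
    (hl : 0 ≤ l) {c₁ c₂ : ℝ → X} (h0 : c₁ 0 = c₂ 0) (h1 : c₁ (2 * l) = c₂ (2 * l))
    (hd : dist (c₁ 0) (c₁ (2 * l)) = 2 * l)
    (hc₁ : ∀ s ∈ Set.Icc 0 (2 * l), ∀ t ∈ Set.Icc 0 (2 * l), dist (c₁ s) (c₁ t) ≤ |s - t|)
    (hc₂ : ∀ s ∈ Set.Icc 0 (2 * l), ∀ t ∈ Set.Icc 0 (2 * l), dist (c₂ s) (c₂ t) ≤ |s - t|)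
    (hb₁ : ∀ t ∈ Set.Icc 0 (2 * l), c₁ t ∈ Metric.ball p r)
    (hb₂ : ∀ t ∈ Set.Icc 0 (2 * l), c₂ t ∈ Metric.ball p r) : c₁ l = c₂ l := by
  obtain ⟨z, E, F, hEF, hE, hF⟩ := h.exists_maps
  have m0 : (0 : ℝ) ∈ Set.Icc 0 (2 * l) := ⟨le_rfl, by linarith⟩
  have ml : l ∈ Set.Icc 0 (2 * l) := ⟨hl, by linarith⟩
  have m1 : 2 * l ∈ Set.Icc 0 (2 * l) := ⟨by linarith, le_rfl⟩
  -- The disk is convex, so the geodesic between the two images stays in it and is carried by `F` to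
  -- a path in `X`. Hence the ends are no closer in the disk than in `X`.
  have hd' : 2 * l ≤ dist (E (c₁ 0)) (E (c₁ (2 * l))) := by
    obtain ⟨e0, f0⟩ := hEF _ (hb₁ 0 m0)
    obtain ⟨e1, f1⟩ := hEF _ (hb₁ _ m1)
    obtain ⟨c, hc, hc0, hc1⟩ := exists_isLine (E (c₁ 0)) (E (c₁ (2 * l)))
    have := dist_comp_le_of_locally_isometric hF (c := c) (a := 0) dist_nonneg
      (fun t _ u _ => (hc.isometry.dist_eq t u).le) (fun t ht => by
        rw [Metric.mem_ball, dist_comm]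
        refine hc.dist_lt ht.1 ht.2 ?_ ?_
        · rw [hc0, dist_comm]; exact e0
        · rw [hc1, dist_comm]; exact e1)
    rwa [hc0, hc1, f0, f1, sub_zero, hd] at this
  have hlip : ∀ c : ℝ → X, (∀ s ∈ Set.Icc 0 (2 * l), ∀ t ∈ Set.Icc 0 (2 * l),
      dist (c s) (c t) ≤ |s - t|) → (∀ t ∈ Set.Icc 0 (2 * l), c t ∈ Metric.ball p r) →
      dist (E (c l)) (E (c 0)) ≤ l ∧ dist (E (c l)) (E (c (2 * l))) ≤ l := by
    intro c hc hb
    have s1 : ∀ t ∈ Set.Icc 0 l, t ∈ Set.Icc 0 (2 * l) := fun t ht => ⟨ht.1, by linarith [ht.2]⟩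
    have s2 : ∀ t ∈ Set.Icc l (2 * l), t ∈ Set.Icc 0 (2 * l) :=
      fun t ht => ⟨by linarith [ht.1], ht.2⟩
    have h1 := dist_comp_le_of_locally_isometric hE hl
      (fun t ht u hu => hc t (s1 t ht) u (s1 u hu)) (fun t ht => hb t (s1 t ht))
    have h2 := dist_comp_le_of_locally_isometric hE (a := l) (b := 2 * l) (by linarith)
      (fun t ht u hu => hc t (s2 t ht) u (s2 u hu)) (fun t ht => hb t (s2 t ht))
    rw [dist_comm] at h1
    exact ⟨by linarith, by linarith⟩
  obtain ⟨a1, a2⟩ := hlip c₁ hc₁ hb₁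
  obtain ⟨b1, b2⟩ := hlip c₂ hc₂ hb₂
  rw [← h0] at b1
  rw [← h1] at b2
  have := eq_of_dist_le_half hd' a1 a2 b1 b2
  rw [← (hEF _ (hb₁ l ml)).2, this, (hEF _ (hb₂ l ml)).2]

/-- A locally isometric bijection of a hyperbolic disk and a ball that preserves the distance from
the centre is a homeomorphism. -/
theorem isEmbeddedDisk_of_bijOn {p : X} {z : ℍ} {r : ℝ} (g : ℍ → X)
    (hg : Set.BijOn g (Metric.ball z r) (Metric.ball p r))
    (hdist : ∀ w ∈ Metric.ball z r, dist (g w) p = dist w z)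
    (hloc : ∀ w ∈ Metric.ball z r, ∃ U ∈ 𝓝 w, ∀ w₁ ∈ U, ∀ w₂ ∈ U,
      dist (g w₁) (g w₂) = dist w₁ w₂) : IsEmbeddedDisk p r := by
  let G : Metric.ball z r → Metric.ball p r := fun w => ⟨g w, hg.mapsTo w.2⟩
  have hbij : Function.Bijective G :=
    ⟨fun w w' h => Subtype.ext (hg.injOn w.2 w'.2 (congrArg Subtype.val h)), fun y => by
      obtain ⟨w, hw, hw'⟩ := hg.surjOn y.2
      exact ⟨⟨w, hw⟩, Subtype.ext hw'⟩⟩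
  have hGloc : ∀ w, ∃ U ∈ 𝓝 w, ∀ w₁ ∈ U, ∀ w₂ ∈ U, dist (G w₁) (G w₂) = dist w₁ w₂ := by
    intro w
    obtain ⟨U, hU, hU'⟩ := hloc w w.2
    exact ⟨Subtype.val ⁻¹' U, continuous_subtype_val.continuousAt.preimage_mem_nhds hU,
      fun w₁ h₁ w₂ h₂ => hU' _ h₁ _ h₂⟩
  have hcont : Continuous G := by
    rw [continuous_iff_continuousAt]
    intro w
    obtain ⟨U, hU, hU'⟩ := hGloc w
    refine tendsto_iff_dist_tendsto_zero.2 ?_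
    have : Filter.Tendsto (fun w' => dist w' w) (𝓝 w) (𝓝 0) :=
      tendsto_iff_dist_tendsto_zero.1 Filter.tendsto_id
    refine this.congr' ?_
    filter_upwards [hU] with w' hw'
    exact (hU' _ hw' _ (mem_of_mem_nhds hU)).symm
  -- A compact set in the open ball has a largest distance from the centre, less than `r`. As this
  -- distance is preserved, the preimage lies in a smaller closed disk.
  have hproper : IsProperMap G := by
    rw [isProperMap_iff_isCompact_preimage]
    refine ⟨hcont, fun K hK => ?_⟩
    rcases K.eq_empty_or_nonempty with rfl | hne
    · simp
    obtain ⟨y, -, hy⟩ := hK.exists_isMaxOn hne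
      (f := fun y => dist (y : X) p) (by fun_prop)
    have hcl : IsClosed (G ⁻¹' K) := hK.isClosed.preimage hcont
    rw [Subtype.isCompact_iff]
    have hr : dist (y : X) p < r := y.2
    have h1 : IsCompact ((↑) ⁻¹' Metric.closedBall z (dist (y : X) p) :
        Set (Metric.ball z r)) := by
      rw [Subtype.isCompact_iff, Subtype.image_preimage_coe, Set.inter_eq_right.2]
      · exact isCompact_closedBall _ _
      · exact Metric.closedBall_subset_ball hr
    rw [← Subtype.isCompact_iff]
    refine h1.of_isClosed_subset hcl fun w hw => ?_
    have := hy hw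
    simp only [Set.mem_ofPred_eq] at this
    rw [Set.mem_preimage, Metric.mem_closedBall, ← hdist w w.2]
    exact this
  have hhom : IsHomeomorph G :=
    isHomeomorph_iff_continuous_isClosedMap_bijective.2 ⟨hcont, hproper.isClosedMap, hbij⟩
  let e := hhom.homeomorph
  have he : ∀ w, e w = G w := fun w => rfl
  refine ⟨z, e.symm, fun x => ?_⟩
  obtain ⟨U, hU, hU'⟩ := hGloc (e.symm x)
  refine ⟨e.symm ⁻¹' U, e.symm.continuous.continuousAt.preimage_mem_nhds hU, ?_⟩
  intro y hy y' hy'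
  rw [← hU' _ hy _ hy', ← he, ← he, e.apply_symm_apply, e.apply_symm_apply]

end EmbeddedDisk

/-! ### The metric of the triangular surface -/

namespace HypTriangle

variable {α β γ : ℝ} (T : HypTriangle α β γ)

/-- The three half-planes. -/
def side (i : Fin 3) : HypHalfPlane := ![T.HA, T.HB, T.HC] i

theorem mem_carrier_iff {z : ℍ} : z ∈ T.carrier ↔ ∀ i, 0 ≤ (T.side i).ht z := by
  simp only [carrier, Set.mem_ofPred_eq, HypHalfPlane.form_nonneg_iff, Fin.forall_fin_succ, side]
  simp

theorem mem_sides_iff {z : ℍ} : z ∈ T.sides ↔ z ∈ T.carrier ∧ ∃ i, (T.side i).ht z = 0 := by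
  simp only [sides, Set.mem_ofPred_eq, HypHalfPlane.form_eq_zero_iff, Fin.exists_fin_succ, side]
  simp

/-- The inclusion of one of the two copies of the triangle in the surface, extended by a constant
outside of the triangle. -/
noncomputable def emb (b : Bool) (z : ℍ) : T.Surface :=
  open Classical in
  let x : T.carrier := if h : z ∈ T.carrier then ⟨z, h⟩ else ⟨_, T.sides_nonempty.some_mem.1⟩
  if b then Metric.toGlueL T.isometry_sidesIncl T.isometry_sidesIncl x
  else Metric.toGlueR T.isometry_sidesIncl T.isometry_sidesIncl x

variable {T}

theorem emb_true {z : ℍ} (h : z ∈ T.carrier) :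
    T.emb true z = Metric.toGlueL T.isometry_sidesIncl T.isometry_sidesIncl ⟨z, h⟩ := by
  simp only [emb, dif_pos h]; rfl

theorem emb_false {z : ℍ} (h : z ∈ T.carrier) :
    T.emb false z = Metric.toGlueR T.isometry_sidesIncl T.isometry_sidesIncl ⟨z, h⟩ := by
  simp only [emb, dif_pos h]; rfl

theorem exists_emb (y : T.Surface) : ∃ b, ∃ z ∈ T.carrier, T.emb b z = y := by
  obtain ⟨x, hx⟩ := Quotient.exists_rep y
  rcases x with ⟨z, hz⟩ | ⟨z, hz⟩
  · exact ⟨true, z, hz, by rw [emb_true hz]; exact hx⟩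
  · exact ⟨false, z, hz, by rw [emb_false hz]; exact hx⟩

theorem dist_emb (b : Bool) {z w : ℍ} (hz : z ∈ T.carrier) (hw : w ∈ T.carrier) :
    dist (T.emb b z) (T.emb b w) = dist z w := by
  cases b
  · rw [emb_false hz, emb_false hw]; rfl
  · rw [emb_true hz, emb_true hw]; rfl

theorem dist_emb_not (b : Bool) {z w : ℍ} (hz : z ∈ T.carrier) (hw : w ∈ T.carrier) :
    dist (T.emb b z) (T.emb (!b) w) = ⨅ s : T.sides, dist z s + dist w s := by
  have key : ∀ z w : ℍ, z ∈ T.carrier → w ∈ T.carrier →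
      dist (T.emb true z) (T.emb false w) = ⨅ s : T.sides, dist z s + dist w s := by
    intro z w hz hw
    rw [emb_true hz, emb_false hw]
    -- `Metric.GlueSpace` glues with gap `0`, which is added to the infimum.
    exact add_zero _
  cases b
  · rw [dist_comm]
    simp only [Bool.not_false]
    rw [key w z hw hz]
    simp only [add_comm]
  · exact key z w hz hw

variable (T) in
/-- No interior angle of the triangle is obtuse. -/
def Nonobtuse : Prop := ∀ i j, i ≠ j → (T.side i).product (T.side j) ≤ 0

theorem nonobtuse_of_cos_nonneg (hα : 0 ≤ Real.cos α) (hβ : 0 ≤ Real.cos β)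
    (hγ : 0 ≤ Real.cos γ) : T.Nonobtuse := by
  intro i j h
  have h1 := T.angleA
  have h2 := T.angleB
  have h3 := T.angleC
  have hs : ∀ H K : HypHalfPlane, H.product K = K.product H := by
    intro H K; simp only [HypHalfPlane.product]; ring
  fin_cases i <;> fin_cases j <;> simp [side] at h ⊢ <;>
    first | linarith | (rw [hs]; linarith)

/-- Reflecting in side `i` changes the height over side `j` by `-2` times the height over `i` times
a product that is not positive. This is where the angles being at most `π/2` matters. -/
theorem Nonobtuse.ht_refl_nonneg (hT : T.Nonobtuse) {z : ℍ} (hz : z ∈ T.carrier) {i j : Fin 3}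
    (h : j ≠ i) : 0 ≤ (T.side j).ht ((T.side i).refl z) := by
  rw [T.mem_carrier_iff] at hz
  rw [HypHalfPlane.ht_refl]
  have := mul_nonneg (hz i) (neg_nonneg.2 (hT j i h))
  linarith [hz j]

/-- The geodesic from the mirror image to `w` crosses the line through side `i`. The other heights
are nonnegative at both ends, so it crosses in the side itself; folding it back gives a path on the
surface. -/
theorem Nonobtuse.dist_emb_not_le (hT : T.Nonobtuse) (b : Bool) (i : Fin 3) {z w : ℍ}
    (hz : z ∈ T.carrier) (hw : w ∈ T.carrier) :
    dist (T.emb b z) (T.emb (!b) w) ≤ dist ((T.side i).refl z) w := by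
  obtain ⟨c, hc, h0, h1⟩ := exists_isLine ((T.side i).refl z) w
  have hz' := T.mem_carrier_iff.1 hz
  have hw' := T.mem_carrier_iff.1 hw
  obtain ⟨t, ht, hti⟩ := hc.exists_ht_eq_zero (H := T.side i) (s := 0)
    (u := dist ((T.side i).refl z) w) dist_nonneg
    (by rw [h0, HypHalfPlane.ht_refl_self]; linarith [hz' i]) (by rw [h1]; exact hw' i)
  have hs : c t ∈ T.sides := by
    refine T.mem_sides_iff.2 ⟨T.mem_carrier_iff.2 fun j => ?_, i, hti⟩
    rcases eq_or_ne j i with rfl | hj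
    · exact hti.ge
    · exact hc.ht_nonneg ht.1 ht.2 (by rw [h0]; exact hT.ht_refl_nonneg hz hj)
        (by rw [h1]; exact hw' j)
  rw [dist_emb_not b hz hw]
  have h2 : dist z (c t) + dist w (c t) = dist ((T.side i).refl z) w := by
    rw [← (T.side i).refl_of_ht_eq_zero hti, ← HypHalfPlane.dist_refl_left,
      (T.side i).refl_of_ht_eq_zero hti]
    have e1 := hc.dist_eq ht.1
    have e2 := hc.dist_eq ht.2
    rw [h0] at e1
    rw [h1, dist_comm] at e2
    linarith
  rw [← h2]
  exact ciInf_le (f := fun s : T.sides => dist z s + dist w s)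
    ⟨0, by rintro _ ⟨s, rfl⟩; positivity⟩ ⟨c t, hs⟩

/-- A path through a point of side `j` unfolds to one from the mirror image in that side, so it is
no shorter than `dist ((T.side j).refl z) w`. -/
theorem Nonobtuse.exists_dist_emb_not (hT : T.Nonobtuse) (b : Bool) {z w : ℍ}
    (hz : z ∈ T.carrier) (hw : w ∈ T.carrier) :
    ∃ i, dist (T.emb b z) (T.emb (!b) w) = dist ((T.side i).refl z) w := by
  obtain ⟨i, hi⟩ := Finite.exists_min fun i => dist ((T.side i).refl z) w
  refine ⟨i, le_antisymm (hT.dist_emb_not_le b i hz hw) ?_⟩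
  rw [dist_emb_not b hz hw]
  refine le_ciInf fun s => ?_
  obtain ⟨-, j, hj⟩ := T.mem_sides_iff.1 s.2
  refine (hi j).trans ((dist_triangle _ (s : ℍ) _).trans ?_)
  rw [HypHalfPlane.dist_refl_left, (T.side j).refl_of_ht_eq_zero hj, dist_comm w]

theorem Nonobtuse.emb_eq_emb_not (hT : T.Nonobtuse) (b : Bool) {z : ℍ} (hz : z ∈ T.carrier)
    {i : Fin 3} (hi : (T.side i).ht z = 0) : T.emb b z = T.emb (!b) z := by
  have := hT.dist_emb_not_le b i hz hz
  rw [(T.side i).refl_of_ht_eq_zero hi, dist_self] at this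
  exact dist_le_zero.1 this

/-- A mirror image that lies in the triangle has height both nonpositive and nonnegative over that
side, hence zero. -/
theorem Nonobtuse.exists_refl_eq (hT : T.Nonobtuse) {b : Bool} {z w : ℍ} (hz : z ∈ T.carrier)
    (hw : w ∈ T.carrier) (h : T.emb b z = T.emb (!b) w) :
    ∃ i, (T.side i).refl z = w ∧ w = z ∧ (T.side i).ht z = 0 := by
  obtain ⟨i, hi⟩ := hT.exists_dist_emb_not b hz hw
  rw [h, dist_self] at hi
  have h1 := dist_eq_zero.1 hi.symm
  have h2 : (T.side i).ht z = 0 := by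
    have h3 := (T.side i).ht_refl_self z
    rw [h1] at h3
    linarith [T.mem_carrier_iff.1 hz i, T.mem_carrier_iff.1 hw i]
  exact ⟨i, h1, by rw [← h1, (T.side i).refl_of_ht_eq_zero h2], h2⟩

end HypTriangle

namespace HypTriangle

variable {α β γ : ℝ} {T : HypTriangle α β γ}

/-! ### Balls of radius at most the injectivity radius are embedded -/

/-- The disks of radius `r` about the mirror images of `p` are disjoint. Every uniqueness claim
about sides below rests on this. -/
theorem eq_of_dist_refl_lt {p w : ℍ} {r : ℝ}
    (hsep : ∀ i j, i ≠ j → 2 * r ≤ dist ((T.side i).refl p) ((T.side j).refl p)) {i j : Fin 3}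
    (hi : dist ((T.side i).refl p) w < r) (hj : dist ((T.side j).refl p) w < r) : i = j := by
  by_contra h
  have := hsep i j h
  have := dist_triangle_right ((T.side i).refl p) ((T.side j).refl p) w
  linarith

theorem dist_refl_lt_of_ht_nonpos {p w : ℍ} {r : ℝ} (hp : p ∈ T.carrier) (hw : dist p w < r)
    {i : Fin 3} (hi : (T.side i).ht w ≤ 0) : dist ((T.side i).refl p) w < r :=
  ((T.side i).dist_refl_le
    (mul_nonpos_of_nonneg_of_nonpos (T.mem_carrier_iff.1 hp i) hi)).trans_lt hw

/-- A point of the disk about `p` that is on or beyond a side is also within `r` of the mirror image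
of `p` in that side. Two sides at once would contradict disjointness; the same argument applies to
the reflected point. -/
theorem ht_pos_of_ht_nonpos {p w : ℍ} {r : ℝ} (hp : p ∈ T.carrier)
    (hsep : ∀ i j, i ≠ j → 2 * r ≤ dist ((T.side i).refl p) ((T.side j).refl p))
    (hw : dist p w < r) {i j : Fin 3} (hi : (T.side i).ht w ≤ 0) (hj : j ≠ i) :
    0 < (T.side j).ht w ∧ 0 < (T.side j).ht ((T.side i).refl w) := by
  have h1 := dist_refl_lt_of_ht_nonpos hp hw hi
  constructor
  · by_contra h
    exact hj (eq_of_dist_refl_lt hsep (dist_refl_lt_of_ht_nonpos hp hw (not_lt.1 h)) h1)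
  · by_contra h
    rw [HypHalfPlane.dist_refl_left] at h1
    refine hj (eq_of_dist_refl_lt hsep (dist_refl_lt_of_ht_nonpos hp h1 (not_lt.1 h)) ?_)
    rwa [HypHalfPlane.dist_refl_refl]

theorem refl_mem_carrier {p w : ℍ} {r : ℝ} (hp : p ∈ T.carrier)
    (hsep : ∀ i j, i ≠ j → 2 * r ≤ dist ((T.side i).refl p) ((T.side j).refl p))
    (hw : dist p w < r) {i : Fin 3} (hi : (T.side i).ht w ≤ 0) :
    (T.side i).refl w ∈ T.carrier := by
  refine T.mem_carrier_iff.2 fun j => ?_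
  rcases eq_or_ne j i with rfl | h
  · rw [HypHalfPlane.ht_refl_self]; linarith
  · exact (ht_pos_of_ht_nonpos hp hsep hw hi h).2.le

variable (T) in
/-- The map of the plane to the surface that is the inclusion of one copy on the triangle, and is
the other copy composed with a reflection beyond a side. -/
noncomputable def unfold (b : Bool) (w : ℍ) : T.Surface :=
  open Classical in
  if h : ∃ i, (T.side i).ht w < 0 then T.emb (!b) ((T.side h.choose).refl w) else T.emb b w

theorem unfold_of_mem (b : Bool) {w : ℍ} (hw : w ∈ T.carrier) : T.unfold b w = T.emb b w := by
  rw [unfold, dif_neg]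
  rintro ⟨i, hi⟩
  linarith [T.mem_carrier_iff.1 hw i]

theorem Nonobtuse.unfold_of_ht_nonpos (hT : T.Nonobtuse) (b : Bool) {p w : ℍ} {r : ℝ}
    (hp : p ∈ T.carrier)
    (hsep : ∀ i j, i ≠ j → 2 * r ≤ dist ((T.side i).refl p) ((T.side j).refl p))
    (hw : dist p w < r) {i : Fin 3} (hi : (T.side i).ht w ≤ 0) :
    T.unfold b w = T.emb (!b) ((T.side i).refl w) := by
  by_cases h : ∃ i, (T.side i).ht w < 0
  · rw [unfold, dif_pos h]
    -- On the disk the side picked by choice is the only possible one.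
    have : h.choose = i := eq_of_dist_refl_lt hsep
      (dist_refl_lt_of_ht_nonpos hp hw h.choose_spec.le) (dist_refl_lt_of_ht_nonpos hp hw hi)
    rw [this]
  · push Not at h
    have hw' := T.mem_carrier_iff.2 h
    have h0 : (T.side i).ht w = 0 := le_antisymm hi (h i)
    rw [unfold_of_mem b hw', (T.side i).refl_of_ht_eq_zero h0, hT.emb_eq_emb_not b hw' h0]

theorem mem_carrier_or (w : ℍ) : w ∈ T.carrier ∨ ∃ i, (T.side i).ht w < 0 := by
  by_cases h : ∃ i, (T.side i).ht w < 0
  · exact Or.inr h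
  · push Not at h
    exact Or.inl (T.mem_carrier_iff.2 h)

theorem Nonobtuse.dist_unfold (hT : T.Nonobtuse) (b : Bool) {p w : ℍ} {r : ℝ}
    (hp : p ∈ T.carrier)
    (hsep : ∀ i j, i ≠ j → 2 * r ≤ dist ((T.side i).refl p) ((T.side j).refl p))
    (hw : dist p w < r) : dist (T.emb b p) (T.unfold b w) = dist p w := by
  rcases T.mem_carrier_or w with h | ⟨i, hi⟩
  · rw [unfold_of_mem b h, dist_emb b hp h]
  · have hq := refl_mem_carrier hp hsep hw hi.le
    rw [hT.unfold_of_ht_nonpos b hp hsep hw hi.le]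
    have h1 := hT.dist_emb_not_le b i hp hq
    obtain ⟨j, hj⟩ := hT.exists_dist_emb_not b hp hq
    rw [HypHalfPlane.dist_refl_refl] at h1
    have : j = i := eq_of_dist_refl_lt (w := (T.side i).refl w) hsep (by linarith)
      (by rwa [HypHalfPlane.dist_refl_refl])
    rw [hj, this, HypHalfPlane.dist_refl_refl]

theorem Nonobtuse.injOn_unfold (hT : T.Nonobtuse) (b : Bool) {p : ℍ} {r : ℝ}
    (hp : p ∈ T.carrier)
    (hsep : ∀ i j, i ≠ j → 2 * r ≤ dist ((T.side i).refl p) ((T.side j).refl p)) :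
    Set.InjOn (T.unfold b) (Metric.ball p r) := by
  have mixed : ∀ w₁ w₂, dist p w₁ < r → dist p w₂ < r → w₁ ∈ T.carrier →
      (∃ i, (T.side i).ht w₂ < 0) → T.unfold b w₁ ≠ T.unfold b w₂ := by
    rintro w₁ w₂ h₁ h₂ hw₁ ⟨i, hi⟩ h
    have hq := refl_mem_carrier hp hsep h₂ hi.le
    rw [unfold_of_mem b hw₁, hT.unfold_of_ht_nonpos b hp hsep h₂ hi.le] at h
    obtain ⟨j, -, hj, hj'⟩ := hT.exists_refl_eq hw₁ hq h
    have e1 := dist_refl_lt_of_ht_nonpos hp h₁ hj'.le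
    have e2 : dist ((T.side i).refl p) w₁ < r := by
      rwa [← hj, HypHalfPlane.dist_refl_refl]
    have e3 := eq_of_dist_refl_lt hsep e1 e2
    rw [e3, ← hj, HypHalfPlane.ht_refl_self] at hj'
    linarith
  intro w₁ h₁ w₂ h₂ h
  rw [Metric.mem_ball'] at h₁ h₂
  rcases T.mem_carrier_or w₁ with c₁ | c₁ <;> rcases T.mem_carrier_or w₂ with c₂ | c₂
  · rw [unfold_of_mem b c₁, unfold_of_mem b c₂, ← dist_eq_zero, dist_emb b c₁ c₂] at h
    exact dist_eq_zero.1 h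
  · exact absurd h (mixed _ _ h₁ h₂ c₁ c₂)
  · exact absurd h.symm (mixed _ _ h₂ h₁ c₂ c₁)
  · obtain ⟨i, hi⟩ := c₁
    obtain ⟨j, hj⟩ := c₂
    rw [hT.unfold_of_ht_nonpos b hp hsep h₁ hi.le, hT.unfold_of_ht_nonpos b hp hsep h₂ hj.le,
      ← dist_eq_zero, dist_emb _ (refl_mem_carrier hp hsep h₁ hi.le)
        (refl_mem_carrier hp hsep h₂ hj.le), dist_eq_zero] at h
    have : i = j := eq_of_dist_refl_lt (w := (T.side i).refl w₁) hsep
      (by rwa [HypHalfPlane.dist_refl_refl]) (by rwa [h, HypHalfPlane.dist_refl_refl])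
    subst this
    exact (T.side i).isometry_refl.injective h

theorem Nonobtuse.surjOn_unfold (hT : T.Nonobtuse) (b : Bool) {p : ℍ} {r : ℝ}
    (hp : p ∈ T.carrier)
    (hsep : ∀ i j, i ≠ j → 2 * r ≤ dist ((T.side i).refl p) ((T.side j).refl p)) :
    Set.SurjOn (T.unfold b) (Metric.ball p r) (Metric.ball (T.emb b p) r) := by
  intro y hy
  obtain ⟨b', q, hq, rfl⟩ := T.exists_emb y
  rw [Metric.mem_ball'] at hy
  by_cases hb : b' = b
  · subst hb
    rw [dist_emb _ hp hq] at hy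
    exact ⟨q, Metric.mem_ball'.2 hy, unfold_of_mem _ hq⟩
  · obtain rfl : b' = !b := by cases b <;> cases b' <;> simp_all
    obtain ⟨j, hj⟩ := hT.exists_dist_emb_not b hp hq
    rw [hj, HypHalfPlane.dist_refl_left] at hy
    refine ⟨(T.side j).refl q, Metric.mem_ball'.2 hy, ?_⟩
    rw [hT.unfold_of_ht_nonpos b hp hsep hy (i := j), HypHalfPlane.refl_refl]
    rw [HypHalfPlane.ht_refl_self]
    linarith [T.mem_carrier_iff.1 hq j]

theorem Nonobtuse.locally_isometric_unfold (hT : T.Nonobtuse) (b : Bool) {p w : ℍ} {r : ℝ}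
    (hp : p ∈ T.carrier)
    (hsep : ∀ i j, i ≠ j → 2 * r ≤ dist ((T.side i).refl p) ((T.side j).refl p))
    (hw : dist p w < r) : ∃ U ∈ 𝓝 w, ∀ w₁ ∈ U, ∀ w₂ ∈ U,
      dist (T.unfold b w₁) (T.unfold b w₂) = dist w₁ w₂ := by
  by_cases hpos : ∀ i, 0 < (T.side i).ht w
  · refine ⟨{w | ∀ i, 0 < (T.side i).ht w}, ?_, fun w₁ h₁ w₂ h₂ => ?_⟩
    · exact Filter.eventually_all.2 fun i =>
        (T.side i).continuous_ht.continuousAt.eventually_const_lt (hpos i)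
    · have h₁' := T.mem_carrier_iff.2 fun i => (h₁ i).le
      have h₂' := T.mem_carrier_iff.2 fun i => (h₂ i).le
      rw [unfold_of_mem b h₁', unfold_of_mem b h₂', dist_emb b h₁' h₂']
  push Not at hpos
  obtain ⟨i, hi⟩ := hpos
  rcases hi.lt_or_eq with hneg | hzero
  · refine ⟨{w' | dist p w' < r ∧ (T.side i).ht w' < 0}, ?_, ?_⟩
    · exact Filter.Eventually.and
        ((continuous_const.dist continuous_id).continuousAt.eventually_lt_const hw)
        ((T.side i).continuous_ht.continuousAt.eventually_lt_const hneg)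
    · rintro w₁ ⟨r₁, c₁⟩ w₂ ⟨r₂, c₂⟩
      rw [hT.unfold_of_ht_nonpos b hp hsep r₁ c₁.le, hT.unfold_of_ht_nonpos b hp hsep r₂ c₂.le,
        dist_emb _ (refl_mem_carrier hp hsep r₁ c₁.le) (refl_mem_carrier hp hsep r₂ c₂.le),
        HypHalfPlane.dist_refl_refl]
  have hj : ∀ j, j ≠ i → 0 < (T.side j).ht w :=
    fun j hj => (ht_pos_of_ht_nonpos hp hsep hw hi hj).1
  -- For points within `δ` of `w`, a shortest connection through another side `j` would make `w` and
  -- its image in `j` closer than `4 * δ`. So near `w` the connection between the sheets uses side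
  -- `i`.
  have hδ : ∃ δ > 0, ∀ j, j ≠ i → 4 * δ ≤ dist ((T.side j).refl w) w := by
    have : Nonempty {j : Fin 3 // j ≠ i} := (exists_ne i).elim fun j hji => ⟨⟨j, hji⟩⟩
    obtain ⟨k, hk⟩ := Finite.exists_min fun j : {j : Fin 3 // j ≠ i} => dist ((T.side j).refl w) w
    refine ⟨dist ((T.side k).refl w) w / 4, ?_, fun j hji => ?_⟩
    · refine div_pos (dist_pos.2 fun h => ?_) (by norm_num)
      exact (hj k k.2).ne' ((T.side k).ht_eq_zero_of_refl_eq h)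
    · have := hk ⟨j, hji⟩
      simp only at this
      linarith
  obtain ⟨δ, hδ0, hδ⟩ := hδ
  refine ⟨{w' | (dist w' w < δ ∧ dist p w' < r) ∧ ∀ j, j ≠ i → 0 < (T.side j).ht w'}, ?_, ?_⟩
  · refine Filter.Eventually.and (Filter.Eventually.and (Metric.ball_mem_nhds w hδ0) ?_) ?_
    · exact (continuous_const.dist continuous_id).continuousAt.eventually_lt_const hw
    · exact Filter.eventually_all.2 fun j => Filter.eventually_imp_distrib_left.2 fun hji =>
        (T.side j).continuous_ht.continuousAt.eventually_const_lt (hj j hji)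
  have mem : ∀ w', (∀ j, j ≠ i → 0 < (T.side j).ht w') → 0 ≤ (T.side i).ht w' →
      w' ∈ T.carrier := by
    intro w' h h'
    refine T.mem_carrier_iff.2 fun j => ?_
    rcases eq_or_ne j i with rfl | hji
    · exact h'
    · exact (h j hji).le
  have mixed : ∀ w₁ w₂, dist w₁ w < δ → dist w₂ w < δ → dist p w₂ < r → w₁ ∈ T.carrier →
      (T.side i).ht w₂ ≤ 0 → dist (T.unfold b w₁) (T.unfold b w₂) = dist w₁ w₂ := by
    intro w₁ w₂ d₁ d₂ h₂ c₁ c₂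
    have hq := refl_mem_carrier hp hsep h₂ c₂
    rw [unfold_of_mem b c₁, hT.unfold_of_ht_nonpos b hp hsep h₂ c₂]
    have e1 := hT.dist_emb_not_le b i c₁ hq
    obtain ⟨j, hj'⟩ := hT.exists_dist_emb_not b c₁ hq
    rw [HypHalfPlane.dist_refl_refl] at e1
    rcases eq_or_ne j i with rfl | hji
    · rw [hj', HypHalfPlane.dist_refl_refl]
    · exfalso
      have hi0 : dist ((T.side i).refl w₂) w = dist w₂ w := by
        rw [HypHalfPlane.dist_refl_left, (T.side i).refl_of_ht_eq_zero hzero]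
      have e2 := dist_triangle4 ((T.side j).refl w) ((T.side j).refl w₁) ((T.side i).refl w₂) w
      rw [HypHalfPlane.dist_refl_refl] at e2
      have e3 := hδ j hji
      have e4 := dist_triangle_right w₁ w₂ w
      rw [dist_comm w w₁, ← hj'] at e2
      linarith
  rintro w₁ ⟨⟨d₁, r₁⟩, h₁⟩ w₂ ⟨⟨d₂, r₂⟩, h₂⟩
  rcases le_total 0 ((T.side i).ht w₁) with c₁ | c₁ <;>
    rcases le_total 0 ((T.side i).ht w₂) with c₂ | c₂
  · rw [unfold_of_mem b (mem _ h₁ c₁), unfold_of_mem b (mem _ h₂ c₂),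
      dist_emb b (mem _ h₁ c₁) (mem _ h₂ c₂)]
  · exact mixed _ _ d₁ d₂ r₂ (mem _ h₁ c₁) c₂
  · rw [dist_comm, mixed _ _ d₂ d₁ r₁ (mem _ h₂ c₂) c₁, dist_comm]
  · rw [hT.unfold_of_ht_nonpos b hp hsep r₁ c₁, hT.unfold_of_ht_nonpos b hp hsep r₂ c₂,
      dist_emb _ (refl_mem_carrier hp hsep r₁ c₁) (refl_mem_carrier hp hsep r₂ c₂),
      HypHalfPlane.dist_refl_refl]

theorem Nonobtuse.isEmbeddedDisk_emb (hT : T.Nonobtuse) (b : Bool) {p : ℍ} {r : ℝ}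
    (hp : p ∈ T.carrier)
    (hsep : ∀ i j, i ≠ j → 2 * r ≤ dist ((T.side i).refl p) ((T.side j).refl p)) :
    IsEmbeddedDisk (T.emb b p) r := by
  refine isEmbeddedDisk_of_bijOn (z := p) (T.unfold b)
    ⟨fun w hw => ?_, hT.injOn_unfold b hp hsep, hT.surjOn_unfold b hp hsep⟩ (fun w hw => ?_)
    (fun w hw => hT.locally_isometric_unfold b hp hsep (Metric.mem_ball'.1 hw))
  · rw [Metric.mem_ball'] at hw ⊢
    rwa [hT.dist_unfold b hp hsep hw]
  · rw [dist_comm, hT.dist_unfold b hp hsep (Metric.mem_ball'.1 hw), dist_comm]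

end HypTriangle

namespace HypTriangle

variable {α β γ : ℝ} {T : HypTriangle α β γ}

/-! ### Embedded balls have at most the injectivity radius -/

theorem _root_.IsLine.exists_ht_eq_zero' {c : ℝ → ℍ} (hc : IsLine c) {H : HypHalfPlane} {s u : ℝ}
    (hsu : s ≤ u) (hs : 0 ≤ H.ht (c s)) (hu : H.ht (c u) ≤ 0) :
    ∃ t ∈ Set.Icc s u, H.ht (c t) = 0 :=
  intermediate_value_Icc' hsu (H.continuous_ht.comp hc.isometry.continuous).continuousOn
    ⟨hu, hs⟩

theorem _root_.IsLine.ht_mid_nonneg {c : ℝ → ℍ} (hc : IsLine c) {H : HypHalfPlane} {l : ℝ}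
    (hl : 0 ≤ l) (h : 0 ≤ H.ht (c 0) + H.ht (c (2 * l))) : 0 ≤ H.ht (c l) := by
  rcases hl.eq_or_lt with rfl | hl
  · rw [mul_zero] at h; linarith
  · have h1 := hc.lor_eq H.normal 0 l (2 * l)
    rw [show 2 * l - l = l by ring, sub_zero, sub_zero, ← mul_add] at h1
    have h2 : 0 < Real.sinh l := Real.sinh_pos_iff.2 hl
    have h3 : 0 < Real.sinh (2 * l) := Real.sinh_pos_iff.2 (by linarith)
    refine nonneg_of_mul_nonneg_right ?_ h3
    exact h1 ▸ mul_nonneg h2.le h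

theorem _root_.IsLine.mem_carrier {c : ℝ → ℍ} (hc : IsLine c) {s t u : ℝ} (hst : s ≤ t)
    (htu : t ≤ u) (hs : c s ∈ T.carrier) (hu : c u ∈ T.carrier) : c t ∈ T.carrier :=
  T.mem_carrier_iff.2 fun i =>
    hc.ht_nonneg hst htu (T.mem_carrier_iff.1 hs i) (T.mem_carrier_iff.1 hu i)

/-- An embedded disk cannot contain both copies of a segment that joins two sides. -/
theorem Nonobtuse.not_isEmbeddedDisk_of_segment (hT : T.Nonobtuse) {P : T.Surface} {r : ℝ}
    {c : ℝ → ℍ} (hc : IsLine c) {s u : ℝ} (hsu : s < u) {i j : Fin 3}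
    (hi : (T.side i).ht (c s) = 0) (hj : (T.side j).ht (c u) = 0) (hs : c s ∈ T.carrier)
    (hu : c u ∈ T.carrier) (hpos : ∀ k, 0 < (T.side k).ht (c s) + (T.side k).ht (c u))
    (hb : ∀ b, ∀ t ∈ Set.Icc s u, T.emb b (c t) ∈ Metric.ball P r) : ¬ IsEmbeddedDisk P r := by
  intro h
  have hsl : s + 2 * ((u - s) / 2) = u := by ring
  have hmem : ∀ t ∈ Set.Icc 0 (2 * ((u - s) / 2)), s + t ∈ Set.Icc s u :=
    fun t ht => ⟨by linarith [ht.1], by linarith [ht.2]⟩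
  have hcar : ∀ t ∈ Set.Icc s u, c t ∈ T.carrier :=
    fun t ht => hc.mem_carrier ht.1 ht.2 hs hu
  have hdist : ∀ b, ∀ t ∈ Set.Icc 0 (2 * ((u - s) / 2)), ∀ t' ∈ Set.Icc 0 (2 * ((u - s) / 2)),
      dist (T.emb b (c (s + t))) (T.emb b (c (s + t'))) ≤ |t - t'| := by
    intro b t ht t' ht'
    rw [dist_emb b (hcar _ (hmem t ht)) (hcar _ (hmem t' ht')), hc.isometry.dist_eq,
      Real.dist_eq, add_sub_add_left_eq_sub]
  -- The copies of the segment in the two sheets are shortest paths with the same ends. If the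
  -- midpoints agree, they lie on a side, which `hpos` excludes.
  have key := h.midpoint_unique (l := (u - s) / 2) (by linarith)
    (c₁ := fun t => T.emb true (c (s + t))) (c₂ := fun t => T.emb false (c (s + t)))
    (by simpa using hT.emb_eq_emb_not true hs hi)
    (by rw [hsl]; exact hT.emb_eq_emb_not true hu hj)
    (by rw [hsl, add_zero, dist_emb true hs hu, hc.dist_eq hsu.le]; ring)
    (hdist true) (hdist false) (fun t ht => hb true _ (hmem t ht))
    (fun t ht => hb false _ (hmem t ht))
  have hm : c (s + (u - s) / 2) ∈ T.carrier := hcar _ ⟨by linarith, by linarith⟩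
  obtain ⟨k, -, -, hk⟩ := hT.exists_refl_eq (b := true) hm hm key
  have := hc.ht_pos (H := T.side k) (s := s) (t := s + (u - s) / 2) (u := u) (by linarith)
    (by linarith) (T.mem_carrier_iff.1 hs k) (T.mem_carrier_iff.1 hu k) (hpos k)
  linarith

/-- The line from the mirror image of `z` to `z` meets side `i` in the foot of the perpendicular,
strictly inside the side as no angle is obtuse. The factor `2` comes from using the length of the
whole line segment as a bound. -/
theorem Nonobtuse.exists_foot (hT : T.Nonobtuse) {z : ℍ} (hz : ∀ k, 0 < (T.side k).ht z)
    (i : Fin 3) : ∃ s ∈ T.carrier, (T.side i).ht s = 0 ∧ (∀ k, k ≠ i → 0 < (T.side k).ht s) ∧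
      ∀ v, (T.side i).ht v = 0 → dist z s ≤ 2 * dist z v := by
  have hzT : z ∈ T.carrier := T.mem_carrier_iff.2 fun k => (hz k).le
  obtain ⟨c, hc, h0, h1⟩ := exists_isLine ((T.side i).refl z) z
  set d := dist ((T.side i).refl z) z with hd
  have hi0 : (T.side i).ht (c 0) < 0 := by
    rw [h0, HypHalfPlane.ht_refl_self]; linarith [hz i]
  have hi1 : 0 < (T.side i).ht (c d) := by rw [h1]; exact hz i
  obtain ⟨t, ht, hti⟩ := hc.exists_ht_eq_zero dist_nonneg hi0.le hi1.le
  have ht0 : 0 < t := lt_of_le_of_ne ht.1 (by rintro rfl; exact hi0.ne hti)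
  have ht1 : t < d := lt_of_le_of_ne ht.2 (by rintro rfl; exact hi1.ne' hti)
  have hpos : ∀ k, k ≠ i → 0 < (T.side k).ht (c t) := by
    intro k hk
    have e0 : 0 ≤ (T.side k).ht (c 0) := by rw [h0]; exact hT.ht_refl_nonneg hzT hk
    have e1 : 0 < (T.side k).ht (c d) := by rw [h1]; exact hz k
    exact hc.ht_pos ht0 ht1 e0 e1.le (by linarith)
  refine ⟨c t, T.mem_carrier_iff.2 fun k => ?_, hti, hpos, fun v hv => ?_⟩
  · rcases eq_or_ne k i with rfl | hk
    · exact hti.ge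
    · exact (hpos k hk).le
  · have e1 := hc.dist_eq ht.2
    rw [h1, dist_comm] at e1
    have e2 : d ≤ dist ((T.side i).refl z) v + dist v z := dist_triangle _ _ _
    rw [HypHalfPlane.dist_refl_left, (T.side i).refl_of_ht_eq_zero hv, dist_comm v] at e2
    linarith

/-- An embedded disk contains no vertex. -/
theorem Nonobtuse.not_isEmbeddedDisk_of_vertex (hT : T.Nonobtuse)
    (hint : ∃ o, ∀ k, 0 < (T.side k).ht o) {P : T.Surface} {r : ℝ} {b : Bool} {v : ℍ}
    (hv : v ∈ T.carrier) {i j : Fin 3} (hij : i ≠ j) (hi : (T.side i).ht v = 0)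
    (hj : (T.side j).ht v = 0) (hP : dist P (T.emb b v) < r) : ¬ IsEmbeddedDisk P r := by
  obtain ⟨o, ho⟩ := hint
  obtain ⟨c, hc, h0, h1⟩ := exists_isLine v o
  have hL : 0 < dist v o := dist_pos.2 (by rintro rfl; exact (ho i).ne' hi)
  set L := dist v o
  -- Feet of perpendiculars from a point at distance `t` from `v` are joined by a segment within `t
  -- + 2t + 4t = 7t` of `v`; `9t` leaves room.
  obtain ⟨t, ht0, htL, htr⟩ : ∃ t, 0 < t ∧ t < L ∧ 9 * t < r - dist P (T.emb b v) := by
    have : 0 < (r - dist P (T.emb b v)) / 16 := by linarith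
    refine ⟨min ((r - dist P (T.emb b v)) / 16) (L / 2), by positivity, ?_, ?_⟩
    · exact (min_le_right _ _).trans_lt (by linarith)
    · have := min_le_left ((r - dist P (T.emb b v)) / 16) (L / 2)
      linarith
  have hz : ∀ k, 0 < (T.side k).ht (c t) := by
    intro k
    have e0 : 0 ≤ (T.side k).ht (c 0) := by rw [h0]; exact T.mem_carrier_iff.1 hv k
    have e1 : 0 < (T.side k).ht (c L) := by rw [h1]; exact ho k
    exact hc.ht_pos ht0 htL e0 e1.le (by linarith)
  have hzv : dist (c t) v = t := by
    have := hc.dist_eq ht0.le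
    rw [h0, sub_zero, dist_comm] at this
    exact this
  obtain ⟨s₁, hs₁, hs₁i, hs₁p, hs₁d⟩ := hT.exists_foot hz i
  obtain ⟨s₂, hs₂, hs₂j, hs₂p, hs₂d⟩ := hT.exists_foot hz j
  have d₁ := hs₁d v hi
  have d₂ := hs₂d v hj
  rw [hzv] at d₁ d₂
  obtain ⟨c', hc', h0', h1'⟩ := exists_isLine s₁ s₂
  have hne : s₁ ≠ s₂ := by
    rintro rfl
    exact (hs₁p j hij.symm).ne' hs₂j
  refine hT.not_isEmbeddedDisk_of_segment (i := i) (j := j) hc' (dist_pos.2 hne)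
    (by rwa [h0']) (by rwa [h1']) (by rwa [h0']) (by rwa [h1']) (fun k => ?_)
    (fun b' u hu => ?_)
  · rw [h0', h1']
    rcases eq_or_ne k i with rfl | hk
    · have := hs₂p k hij
      linarith
    · have := hs₁p k hk
      have := T.mem_carrier_iff.1 hs₂ k
      linarith
  · have hcu : c' u ∈ T.carrier := hc'.mem_carrier hu.1 hu.2 (by rwa [h0']) (by rwa [h1'])
    have hvv : T.emb b v = T.emb b' v := by
      by_cases hb : b' = b
      · rw [hb]
      · obtain rfl : b' = !b := by cases b <;> cases b' <;> simp_all
        exact hT.emb_eq_emb_not b hv hi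
    have e1 := dist_triangle P (T.emb b v) (T.emb b' (c' u))
    have e2 : dist (T.emb b v) (T.emb b' (c' u)) = dist v (c' u) := by
      rw [hvv, dist_emb b' hv hcu]
    have e3 := hc'.dist_eq hu.1
    rw [h0'] at e3
    have e4 := dist_triangle4 v (c t) s₁ (c' u)
    have e5 := dist_triangle_left s₁ s₂ (c t)
    rw [dist_comm v (c t)] at e4
    rw [Metric.mem_ball']
    linarith [hu.2]

theorem Nonobtuse.two_mul_le_of_isEmbeddedDisk (hT : T.Nonobtuse)
    (hint : ∃ o, ∀ k, 0 < (T.side k).ht o) {r : ℝ} {b : Bool} {p : ℍ} (hp : p ∈ T.carrier)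
    (h : IsEmbeddedDisk (T.emb b p) r) {i j : Fin 3} (hij : i ≠ j) :
    2 * r ≤ dist ((T.side i).refl p) ((T.side j).refl p) := by
  by_contra hlt
  have hp' := T.mem_carrier_iff.1 hp
  obtain ⟨c, hc, h0, h1⟩ := exists_isLine ((T.side i).refl p) ((T.side j).refl p)
  obtain ⟨l, hl⟩ : ∃ l, dist ((T.side i).refl p) ((T.side j).refl p) = 2 * l :=
    ⟨_, (mul_div_cancel₀ _ two_ne_zero).symm⟩
  have hl0 : 0 ≤ l := by linarith [hl ▸ dist_nonneg (x := (T.side i).refl p)]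
  have hlr : l < r := by linarith
  rw [hl] at h1
  have hii : (T.side i).ht (c 0) ≤ 0 := by rw [h0, HypHalfPlane.ht_refl_self]; linarith [hp' i]
  have hjj : (T.side j).ht (c (2 * l)) ≤ 0 := by
    rw [h1, HypHalfPlane.ht_refl_self]; linarith [hp' j]
  have h0nn : ∀ k, k ≠ i → 0 ≤ (T.side k).ht (c 0) := fun k hk => by
    rw [h0]; exact hT.ht_refl_nonneg hp hk
  have h1nn : ∀ k, k ≠ j → 0 ≤ (T.side k).ht (c (2 * l)) := fun k hk => by
    rw [h1]; exact hT.ht_refl_nonneg hp hk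
  -- Over side `i` the heights of the two ends are `-h` and `h` plus a nonnegative term, so the
  -- midpoint is on the inner side; likewise for side `j`.
  have hm : c l ∈ T.carrier := by
    refine T.mem_carrier_iff.2 fun k => hc.ht_mid_nonneg hl0 ?_
    rcases eq_or_ne k i with rfl | hki
    · rw [h0, h1, HypHalfPlane.ht_refl_self, HypHalfPlane.ht_refl]
      have := mul_nonneg (hp' j) (neg_nonneg.2 (hT k j hij))
      linarith
    rcases eq_or_ne k j with rfl | hkj
    · rw [h0, h1, HypHalfPlane.ht_refl_self, HypHalfPlane.ht_refl]
      have := mul_nonneg (hp' i) (neg_nonneg.2 (hT k i hki))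
      linarith
    · exact add_nonneg (h0nn k hki) (h1nn k hkj)
  have hm' := T.mem_carrier_iff.1 hm
  obtain ⟨t₁, ht₁, hi₁⟩ := hc.exists_ht_eq_zero hl0 hii (hm' i)
  obtain ⟨t₂, ht₂, hj₂⟩ := hc.exists_ht_eq_zero' (by linarith : l ≤ 2 * l) (hm' j) hjj
  have hs₁ : c t₁ ∈ T.carrier := by
    refine T.mem_carrier_iff.2 fun k => ?_
    rcases eq_or_ne k i with rfl | hk
    · exact hi₁.ge
    · exact hc.ht_nonneg ht₁.1 ht₁.2 (h0nn k hk) (hm' k)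
  have hs₂ : c t₂ ∈ T.carrier := by
    refine T.mem_carrier_iff.2 fun k => ?_
    rcases eq_or_ne k j with rfl | hk
    · exact hj₂.ge
    · exact hc.ht_nonneg ht₂.1 ht₂.2 (hm' k) (h1nn k hk)
  have d₁ : dist p (c t₁) < r := by
    have e := hc.dist_eq ht₁.1
    rw [h0, HypHalfPlane.dist_refl_left, (T.side i).refl_of_ht_eq_zero hi₁] at e
    linarith [ht₁.2]
  have d₂ : dist p (c t₂) < r := by
    have e := hc.dist_eq ht₂.2
    rw [h1, dist_comm, HypHalfPlane.dist_refl_left, (T.side j).refl_of_ht_eq_zero hj₂] at e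
    linarith [ht₂.1]
  -- The crossing points lie in the disk, which contains no vertex.
  have pos₁ : ∀ k, k ≠ i → 0 < (T.side k).ht (c t₁) := fun k hk =>
    lt_of_le_of_ne (T.mem_carrier_iff.1 hs₁ k) fun hk0 =>
      hT.not_isEmbeddedDisk_of_vertex hint (b := b) hs₁ hk hk0.symm hi₁
        (by rwa [dist_emb b hp hs₁]) h
  have pos₂ : ∀ k, k ≠ j → 0 < (T.side k).ht (c t₂) := fun k hk =>
    lt_of_le_of_ne (T.mem_carrier_iff.1 hs₂ k) fun hk0 =>
      hT.not_isEmbeddedDisk_of_vertex hint (b := b) hs₂ hk hk0.symm hj₂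
        (by rwa [dist_emb b hp hs₂]) h
  have hlt₁₂ : t₁ < t₂ := by
    refine lt_of_le_of_ne (ht₁.2.trans ht₂.1) fun heq => ?_
    rw [← heq] at hj₂
    exact (pos₁ j hij.symm).ne' hj₂
  refine hT.not_isEmbeddedDisk_of_segment (i := i) (j := j) hc hlt₁₂ hi₁ hj₂ hs₁ hs₂
    (fun k => ?_) (fun b' t ht => ?_) h
  · rcases eq_or_ne k i with rfl | hk
    · have := pos₂ k hij
      linarith
    · have := pos₁ k hk
      have := T.mem_carrier_iff.1 hs₂ k
      linarith
  · have hct := hc.mem_carrier ht.1 ht.2 hs₁ hs₂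
    rw [Metric.mem_ball']
    by_cases hb : b' = b
    · rw [hb, dist_emb b hp hct]
      exact hc.dist_lt ht.1 ht.2 d₁ d₂
    · obtain rfl : b' = !b := by cases b <;> cases b' <;> simp_all
      -- On the other sheet, the distance from `p` is at most that along `c` to the nearer mirror
      -- image, hence at most `l < r`.
      rcases le_total t l with htl | htl
      · have e := hc.dist_eq (ht₁.1.trans ht.1)
        rw [h0] at e
        linarith [hT.dist_emb_not_le b i hp hct]
      · have e := hc.dist_eq (ht.2.trans ht₂.2)
        rw [h1, dist_comm] at e
        linarith [hT.dist_emb_not_le b j hp hct]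

end HypTriangle

/-! ### The Gram matrix of the normals -/

/-- The first row of the adjugate of the Gram matrix of the normals of a triangle, applied to a
vector, if the cosines of the angles are `a, b, c`. -/
def gramAdj (a b c u v w : ℝ) : ℝ := (1 - a ^ 2) * u + (c + a * b) * v + (b + a * c) * w

/-- The determinant of the Gram matrix of the normals of a triangle. -/
def gramDet (a b c : ℝ) : ℝ := a ^ 2 + b ^ 2 + c ^ 2 + 2 * a * b * c - 1

/-- In terms of the products with three independent vectors, the form is given by the inverse of
their Gram matrix. Multiplying by the determinant leaves a polynomial identity, valid without
independence. -/
theorem gram_identity (V V' n₀ n₁ n₂ : ℝ × ℝ × ℝ) {a b c : ℝ} (h₀ : lor n₀ n₀ = -1)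
    (h₁ : lor n₁ n₁ = -1) (h₂ : lor n₂ n₂ = -1) (ha : lor n₁ n₂ = a) (hb : lor n₂ n₀ = b)
    (hc : lor n₀ n₁ = c) :
    gramAdj a b c (lor V n₀) (lor V n₁) (lor V n₂) * lor V' n₀ +
      gramAdj b c a (lor V n₁) (lor V n₂) (lor V n₀) * lor V' n₁ +
      gramAdj c a b (lor V n₂) (lor V n₀) (lor V n₁) * lor V' n₂ =
    gramDet a b c * lor V V' := by
  have key : (lor n₁ n₁ * lor n₂ n₂ - lor n₁ n₂ ^ 2) * lor V n₀ * lor V' n₀ +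
      (lor n₀ n₀ * lor n₂ n₂ - lor n₂ n₀ ^ 2) * lor V n₁ * lor V' n₁ +
      (lor n₀ n₀ * lor n₁ n₁ - lor n₀ n₁ ^ 2) * lor V n₂ * lor V' n₂ +
      (lor n₁ n₂ * lor n₂ n₀ - lor n₀ n₁ * lor n₂ n₂) *
        (lor V n₀ * lor V' n₁ + lor V n₁ * lor V' n₀) +
      (lor n₁ n₂ * lor n₀ n₁ - lor n₂ n₀ * lor n₁ n₁) *
        (lor V n₀ * lor V' n₂ + lor V n₂ * lor V' n₀) +
      (lor n₂ n₀ * lor n₀ n₁ - lor n₁ n₂ * lor n₀ n₀) *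
        (lor V n₁ * lor V' n₂ + lor V n₂ * lor V' n₁) =
      (lor n₀ n₀ * lor n₁ n₁ * lor n₂ n₂ + 2 * lor n₀ n₁ * lor n₁ n₂ * lor n₂ n₀ -
        lor n₀ n₀ * lor n₁ n₂ ^ 2 - lor n₁ n₁ * lor n₂ n₀ ^ 2 - lor n₂ n₂ * lor n₀ n₁ ^ 2) *
        lor V V' := by
    simp only [lor]
    ring
  rw [h₀, h₁, h₂, ha, hb, hc] at key
  simp only [gramAdj, gramDet]
  linear_combination key

/-- For the heights of a point the bracket equals `gramDet`, so the square is an affine function of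
the quadratic form in `v` and `w` alone, which measures the distance between two mirror images. -/
theorem gramAdj_sq (a b c u v w : ℝ) :
    gramAdj a b c u v w ^ 2 =
      (1 - a ^ 2) * (gramAdj a b c u v w * u + gramAdj b c a v w u * v + gramAdj c a b w u v * w)
        + gramDet a b c * (v ^ 2 + w ^ 2 + 2 * v * w * a) := by
  simp only [gramAdj, gramDet]; ring

theorem cos_nonneg_of_mem {α : ℝ} (hα : α ∈ Set.Icc 0 (Real.pi / 2)) : 0 ≤ Real.cos α :=
  Real.cos_nonneg_of_neg_pi_div_two_le_of_le (by linarith [hα.1, Real.pi_pos]) hα.2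

theorem gramDet_pos {α β γ : ℝ} (hα : α ∈ Set.Icc 0 (Real.pi / 2))
    (hβ : β ∈ Set.Icc 0 (Real.pi / 2)) (hγ : γ ∈ Set.Icc 0 (Real.pi / 2))
    (hsum : α + β + γ < Real.pi) :
    0 < Real.cos γ + Real.cos α * Real.cos β ∧
      0 < gramDet (Real.cos α) (Real.cos β) (Real.cos γ) := by
  have hpi := Real.pi_pos
  have h1 : Real.cos (Real.pi - (α + β)) < Real.cos γ :=
    Real.cos_lt_cos_of_nonneg_of_le_pi hγ.1 (by linarith [hα.1, hβ.1]) (by linarith)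
  rw [Real.cos_pi_sub, Real.cos_add] at h1
  have h2 : 0 ≤ Real.sin α * Real.sin β :=
    mul_nonneg (Real.sin_nonneg_of_nonneg_of_le_pi hα.1 (by linarith [hα.2]))
      (Real.sin_nonneg_of_nonneg_of_le_pi hβ.1 (by linarith [hβ.2]))
  -- The difference of the two squares is the Gram determinant.
  have h3 : (Real.sin α * Real.sin β) ^ 2 < (Real.cos γ + Real.cos α * Real.cos β) ^ 2 :=
    pow_lt_pow_left₀ (by linarith) h2 two_ne_zero
  rw [mul_pow, Real.sin_sq, Real.sin_sq] at h3
  refine ⟨by linarith, ?_⟩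
  simp only [gramDet]
  linarith

namespace HypTriangle

variable {α β γ : ℝ} {T : HypTriangle α β γ}

theorem lor_normal_sides :
    lor (T.side 1).normal (T.side 2).normal = Real.cos α ∧
    lor (T.side 2).normal (T.side 0).normal = Real.cos β ∧
    lor (T.side 0).normal (T.side 1).normal = Real.cos γ := by
  simp only [HypHalfPlane.lor_normal]
  exact ⟨by simp [side, T.angleA], by simp [side, T.angleB], by simp [side, T.angleC]⟩

/-- The bilinear relation between the heights of two points over the sides. -/
theorem gram_ht (V : ℝ × ℝ × ℝ) (z : ℍ) :
    gramAdj (Real.cos α) (Real.cos β) (Real.cos γ) (lor V (T.side 0).normal)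
        (lor V (T.side 1).normal) (lor V (T.side 2).normal) * (T.side 0).ht z +
      gramAdj (Real.cos β) (Real.cos γ) (Real.cos α) (lor V (T.side 1).normal)
        (lor V (T.side 2).normal) (lor V (T.side 0).normal) * (T.side 1).ht z +
      gramAdj (Real.cos γ) (Real.cos α) (Real.cos β) (lor V (T.side 2).normal)
        (lor V (T.side 0).normal) (lor V (T.side 1).normal) * (T.side 2).ht z =
    gramDet (Real.cos α) (Real.cos β) (Real.cos γ) * lor V (vec z) := by
  obtain ⟨ha, hb, hc⟩ := T.lor_normal_sides
  exact gram_identity V (vec z) _ _ _ (HypHalfPlane.lor_normal_self _)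
    (HypHalfPlane.lor_normal_self _) (HypHalfPlane.lor_normal_self _) ha hb hc

theorem gramAdj_pos {a b c u v w : ℝ} (ha : a ≤ 1) (ha0 : 0 ≤ a) (hb : 0 < c + a * b)
    (hc : 0 < b + a * c) (hu : 0 ≤ u) (hv : 0 < v) (hw : 0 < w) : 0 < gramAdj a b c u v w := by
  have : 0 ≤ 1 - a ^ 2 := by nlinarith
  unfold gramAdj
  positivity

theorem gramAdj_nonneg {a b c u v w : ℝ} (ha : a ≤ 1) (ha0 : 0 ≤ a) (hb : 0 < c + a * b)
    (hc : 0 < b + a * c) (hu : 0 ≤ u) (hv : 0 ≤ v) (hw : 0 ≤ w) : 0 ≤ gramAdj a b c u v w := by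
  have : 0 ≤ 1 - a ^ 2 := by nlinarith
  unfold gramAdj
  positivity

variable (T) in
/-- There is a point with prescribed heights over the sides. -/
theorem exists_of_ht (hα : α ∈ Set.Icc 0 (Real.pi / 2)) (hβ : β ∈ Set.Icc 0 (Real.pi / 2))
    (hγ : γ ∈ Set.Icc 0 (Real.pi / 2)) (hsum : α + β + γ < Real.pi) {u v w : ℝ} (hu : 0 < u)
    (hv : 0 < v) (hw : 0 < w)
    (h : gramAdj (Real.cos α) (Real.cos β) (Real.cos γ) u v w * u +
      gramAdj (Real.cos β) (Real.cos γ) (Real.cos α) v w u * v +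
      gramAdj (Real.cos γ) (Real.cos α) (Real.cos β) w u v * w =
        gramDet (Real.cos α) (Real.cos β) (Real.cos γ)) :
    ∃ o : ℍ, (T.side 0).ht o = u ∧ (T.side 1).ht o = v ∧ (T.side 2).ht o = w := by
  obtain ⟨hc', hD⟩ := gramDet_pos hα hβ hγ hsum
  have ha' := (gramDet_pos hβ hγ hα (by linarith)).1
  have hb' := (gramDet_pos hγ hα hβ (by linarith)).1
  have ca := cos_nonneg_of_mem hα
  have cb := cos_nonneg_of_mem hβ
  have cc := cos_nonneg_of_mem hγ
  have k₀ := gramAdj_pos (u := u) (Real.cos_le_one α) ca hc' (by linarith) hu.le hv hw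
  have k₁ := gramAdj_pos (u := v) (Real.cos_le_one β) cb ha' (by linarith) hv.le hw hu
  have k₂ := gramAdj_pos (u := w) (Real.cos_le_one γ) cc hb' (by linarith) hw.le hu hv
  obtain ⟨ha, hb, hc⟩ := T.lor_normal_sides
  obtain ⟨z, hz⟩ := T.nonempty
  have hz' := T.mem_carrier_iff.1 hz
  set D := gramDet (Real.cos α) (Real.cos β) (Real.cos γ) with hDdef
  set K₀ := gramAdj (Real.cos α) (Real.cos β) (Real.cos γ) u v w with hK₀
  set K₁ := gramAdj (Real.cos β) (Real.cos γ) (Real.cos α) v w u with hK₁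
  set K₂ := gramAdj (Real.cos γ) (Real.cos α) (Real.cos β) w u v with hK₂
  -- The vector with products `u`, `v`, `w`, obtained by inverting the Gram matrix; `h` makes it a
  -- unit vector.
  obtain ⟨V, hV⟩ : ∃ V, V = (1 / D) • (K₀ • (T.side 0).normal + (K₁ • (T.side 1).normal +
      K₂ • (T.side 2).normal)) := ⟨_, rfl⟩
  have e : ∀ n, lor V n = (K₀ * lor (T.side 0).normal n + (K₁ * lor (T.side 1).normal n +
      K₂ * lor (T.side 2).normal n)) / D := by
    intro n
    rw [hV]
    simp only [lor_smul_left, lor_add_left]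
    ring
  have e₀ : lor V (T.side 0).normal = u := by
    rw [e, HypHalfPlane.lor_normal_self, lor_comm (T.side 1).normal, hc, hb, div_eq_iff hD.ne',
      hDdef, hK₀, hK₁, hK₂]
    simp only [gramAdj, gramDet]; ring
  have e₁ : lor V (T.side 1).normal = v := by
    rw [e, HypHalfPlane.lor_normal_self, lor_comm (T.side 2).normal, hc, ha, div_eq_iff hD.ne',
      hDdef, hK₀, hK₁, hK₂]
    simp only [gramAdj, gramDet]; ring
  have e₂ : lor V (T.side 2).normal = w := by
    rw [e, HypHalfPlane.lor_normal_self, lor_comm (T.side 0).normal, hb, ha, div_eq_iff hD.ne',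
      hDdef, hK₀, hK₁, hK₂]
    simp only [gramAdj, gramDet]; ring
  have eV : lor V V = 1 := by
    rw [e, lor_comm _ V, lor_comm _ V, lor_comm _ V, e₀, e₁, e₂, div_eq_one_iff_eq hD.ne', ← h]
    ring
  -- This selects the upper sheet: the coefficients are positive and the heights of `z` are
  -- nonnegative. They cannot all vanish, since that would force `gramDet` to be zero.
  have hpos : 0 < lor V (vec z) := by
    have g := T.gram_ht V z
    rw [e₀, e₁, e₂] at g
    have hzz := T.gram_ht (vec z) z
    rw [lor_vec_self, mul_one] at hzz
    change gramAdj _ _ _ ((T.side 0).ht z) ((T.side 1).ht z) ((T.side 2).ht z) * _ +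
      gramAdj _ _ _ ((T.side 1).ht z) ((T.side 2).ht z) ((T.side 0).ht z) * _ +
      gramAdj _ _ _ ((T.side 2).ht z) ((T.side 0).ht z) ((T.side 1).ht z) * _ = _ at hzz
    refine pos_of_mul_pos_right ?_ hD.le
    rw [← g]
    by_contra hneg
    have p₀ := mul_nonneg k₀.le (hz' 0)
    have p₁ := mul_nonneg k₁.le (hz' 1)
    have p₂ := mul_nonneg k₂.le (hz' 2)
    have z₀ := (mul_eq_zero.1 (le_antisymm (by linarith) p₀)).resolve_left k₀.ne'
    have z₁ := (mul_eq_zero.1 (le_antisymm (by linarith) p₁)).resolve_left k₁.ne'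
    have z₂ := (mul_eq_zero.1 (le_antisymm (by linarith) p₂)).resolve_left k₂.ne'
    rw [z₀, z₁, z₂] at hzz
    simp only [mul_zero, add_zero] at hzz
    exact hD.ne hzz
  obtain ⟨o, ho⟩ := exists_vec_eq eV hpos
  exact ⟨o, by rw [HypHalfPlane.ht, ho, e₀], by rw [HypHalfPlane.ht, ho, e₁],
    by rw [HypHalfPlane.ht, ho, e₂]⟩

theorem gramAdj_ht_sq (z : ℍ) :
    gramAdj (Real.cos α) (Real.cos β) (Real.cos γ) ((T.side 0).ht z) ((T.side 1).ht z)
        ((T.side 2).ht z) ^ 2 = gramDet (Real.cos α) (Real.cos β) (Real.cos γ) *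
      (1 - Real.cos α ^ 2 +
        Real.sinh (dist ((T.side 1).refl z) ((T.side 2).refl z) / 2) ^ 2) ∧
    gramAdj (Real.cos β) (Real.cos γ) (Real.cos α) ((T.side 1).ht z) ((T.side 2).ht z)
        ((T.side 0).ht z) ^ 2 = gramDet (Real.cos α) (Real.cos β) (Real.cos γ) *
      (1 - Real.cos β ^ 2 +
        Real.sinh (dist ((T.side 2).refl z) ((T.side 0).refl z) / 2) ^ 2) ∧
    gramAdj (Real.cos γ) (Real.cos α) (Real.cos β) ((T.side 2).ht z) ((T.side 0).ht z)
        ((T.side 1).ht z) ^ 2 = gramDet (Real.cos α) (Real.cos β) (Real.cos γ) *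
      (1 - Real.cos γ ^ 2 +
        Real.sinh (dist ((T.side 0).refl z) ((T.side 1).refl z) / 2) ^ 2) := by
  obtain ⟨ha, hb, hc⟩ := T.lor_normal_sides
  rw [HypHalfPlane.lor_normal] at ha hb hc
  have hzz := T.gram_ht (vec z) z
  rw [lor_vec_self, mul_one] at hzz
  change gramAdj _ _ _ ((T.side 0).ht z) ((T.side 1).ht z) ((T.side 2).ht z) * _ +
      gramAdj _ _ _ ((T.side 1).ht z) ((T.side 2).ht z) ((T.side 0).ht z) * _ +
      gramAdj _ _ _ ((T.side 2).ht z) ((T.side 0).ht z) ((T.side 1).ht z) * _ = _ at hzz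
  simp only [HypHalfPlane.sinh_half_dist_refl_sq, neg_eq_iff_eq_neg.1 ha,
    neg_eq_iff_eq_neg.1 hb, neg_eq_iff_eq_neg.1 hc]
  refine ⟨?_, ?_, ?_⟩
  · rw [gramAdj_sq, hzz]; ring
  · rw [gramAdj_sq]
    have : gramDet (Real.cos β) (Real.cos γ) (Real.cos α) =
      gramDet (Real.cos α) (Real.cos β) (Real.cos γ) := by simp only [gramDet]; ring
    rw [this]; linear_combination (1 - Real.cos β ^ 2) * hzz
  · rw [gramAdj_sq]
    have : gramDet (Real.cos γ) (Real.cos α) (Real.cos β) =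
      gramDet (Real.cos α) (Real.cos β) (Real.cos γ) := by simp only [gramDet]; ring
    rw [this]; linear_combination (1 - Real.cos γ ^ 2) * hzz

/-- The distances of the mirror images of a point cannot all be larger than those of another. -/
theorem exists_dist_refl_le (hα : α ∈ Set.Icc 0 (Real.pi / 2)) (hβ : β ∈ Set.Icc 0 (Real.pi / 2))
    (hγ : γ ∈ Set.Icc 0 (Real.pi / 2)) (hsum : α + β + γ < Real.pi) {p o : ℍ}
    (hp : p ∈ T.carrier) : ∃ i j, i ≠ j ∧
      dist ((T.side i).refl p) ((T.side j).refl p) ≤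
        dist ((T.side i).refl o) ((T.side j).refl o) := by
  by_contra hcon
  push Not at hcon
  obtain ⟨hc', hD⟩ := gramDet_pos hα hβ hγ hsum
  have ha' := (gramDet_pos hβ hγ hα (by linarith)).1
  have hb' := (gramDet_pos hγ hα hβ (by linarith)).1
  have ca := cos_nonneg_of_mem hα
  have cb := cos_nonneg_of_mem hβ
  have cc := cos_nonneg_of_mem hγ
  have hp' := T.mem_carrier_iff.1 hp
  have hlt : ∀ i j, i ≠ j → Real.sinh (dist ((T.side i).refl o) ((T.side j).refl o) / 2) ^ 2 <
      Real.sinh (dist ((T.side i).refl p) ((T.side j).refl p) / 2) ^ 2 := by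
    intro i j hij
    have := hcon i j hij
    exact pow_lt_pow_left₀ (Real.sinh_lt_sinh.2 (by linarith))
      (Real.sinh_nonneg_iff.2 (by positivity)) two_ne_zero
  obtain ⟨p₀, p₁, p₂⟩ := T.gramAdj_ht_sq p
  obtain ⟨o₀, o₁, o₂⟩ := T.gramAdj_ht_sq o
  have k₀ := gramAdj_nonneg (Real.cos_le_one α) ca hc' (by linarith) (hp' 0) (hp' 1) (hp' 2)
  have k₁ := gramAdj_nonneg (Real.cos_le_one β) cb ha' (by linarith) (hp' 1) (hp' 2) (hp' 0)
  have k₂ := gramAdj_nonneg (Real.cos_le_one γ) cc hb' (by linarith) (hp' 2) (hp' 0) (hp' 1)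
  have l₀ : gramAdj (Real.cos α) (Real.cos β) (Real.cos γ) ((T.side 0).ht o)
      ((T.side 1).ht o) ((T.side 2).ht o) <
      gramAdj (Real.cos α) (Real.cos β) (Real.cos γ) ((T.side 0).ht p)
      ((T.side 1).ht p) ((T.side 2).ht p) := lt_of_pow_lt_pow_left₀ 2 k₀
    (by rw [p₀, o₀]; exact mul_lt_mul_of_pos_left (by linarith [hlt 1 2 (by decide)]) hD)
  have l₁ : gramAdj (Real.cos β) (Real.cos γ) (Real.cos α) ((T.side 1).ht o)
      ((T.side 2).ht o) ((T.side 0).ht o) <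
      gramAdj (Real.cos β) (Real.cos γ) (Real.cos α) ((T.side 1).ht p)
      ((T.side 2).ht p) ((T.side 0).ht p) := lt_of_pow_lt_pow_left₀ 2 k₁
    (by rw [p₁, o₁]; exact mul_lt_mul_of_pos_left (by linarith [hlt 2 0 (by decide)]) hD)
  have l₂ : gramAdj (Real.cos γ) (Real.cos α) (Real.cos β) ((T.side 2).ht o)
      ((T.side 0).ht o) ((T.side 1).ht o) <
      gramAdj (Real.cos γ) (Real.cos α) (Real.cos β) ((T.side 2).ht p)
      ((T.side 0).ht p) ((T.side 1).ht p) := lt_of_pow_lt_pow_left₀ 2 k₂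
    (by rw [p₂, o₂]; exact mul_lt_mul_of_pos_left (by linarith [hlt 0 1 (by decide)]) hD)
  have gp := T.gram_ht (vec p) p
  have go := T.gram_ht (vec o) p
  -- With `K` the adjugate entries, `h` the heights and `D` the determinant: `D ≤ D * lor (vec o)
  -- (vec p) = ∑ K_i(o) h_i(p) ≤ ∑ K_i(p) h_i(p) = D`. As each `K_i(o) < K_i(p)`, all `h_i(p)`
  -- vanish, and so would `D`.
  have h1 := mul_le_mul_of_nonneg_left (one_le_lor_vec o p) hD.le
  rw [lor_vec_self] at gp
  rw [← go, ← gp] at h1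
  change gramAdj _ _ _ ((T.side 0).ht p) ((T.side 1).ht p) ((T.side 2).ht p) * _ +
      gramAdj _ _ _ ((T.side 1).ht p) ((T.side 2).ht p) ((T.side 0).ht p) * _ +
      gramAdj _ _ _ ((T.side 2).ht p) ((T.side 0).ht p) ((T.side 1).ht p) * _ ≤
    gramAdj _ _ _ ((T.side 0).ht o) ((T.side 1).ht o) ((T.side 2).ht o) * _ +
      gramAdj _ _ _ ((T.side 1).ht o) ((T.side 2).ht o) ((T.side 0).ht o) * _ +
      gramAdj _ _ _ ((T.side 2).ht o) ((T.side 0).ht o) ((T.side 1).ht o) * _ at h1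
  have m₀ := mul_nonneg (sub_nonneg.2 l₀.le) (hp' 0)
  have m₁ := mul_nonneg (sub_nonneg.2 l₁.le) (hp' 1)
  have m₂ := mul_nonneg (sub_nonneg.2 l₂.le) (hp' 2)
  have z₀ := (mul_eq_zero.1 (le_antisymm (by linarith) m₀)).resolve_left (sub_pos.2 l₀).ne'
  have z₁ := (mul_eq_zero.1 (le_antisymm (by linarith) m₁)).resolve_left (sub_pos.2 l₁).ne'
  have z₂ := (mul_eq_zero.1 (le_antisymm (by linarith) m₂)).resolve_left (sub_pos.2 l₂).ne'
  rw [z₀, z₁, z₂] at gp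
  simp only [mul_zero, add_zero, mul_one] at gp
  exact hD.ne gp

end HypTriangle

/-! ### The equation `F = 0` -/

/-- Half of the total angle at the centre of a maximal disk of radius `r`, where `x = cosh r`. -/
noncomputable def halfAngle (α β γ x : ℝ) : ℝ :=
  Real.arcsin (Real.cos α / x) + Real.arcsin (Real.cos β / x) + Real.arcsin (Real.cos γ / x) +
    3 * Real.arcsin (1 / (2 * x))

theorem arcsin_div_mem {c x : ℝ} (hc : 0 ≤ c) (hx : 0 < x) :
    0 ≤ Real.arcsin (c / x) ∧ Real.arcsin (c / x) ≤ Real.pi / 2 :=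
  ⟨Real.arcsin_nonneg.2 (by positivity), Real.arcsin_le_pi_div_two _⟩

theorem sin_arcsin_div {c x : ℝ} (hc : 0 ≤ c) (hc1 : c ≤ 1) (hx : 1 ≤ x) :
    Real.sin (Real.arcsin (c / x)) = c / x := by
  have hx0 : 0 < x := by linarith
  have : 0 ≤ c / x := by positivity
  exact Real.sin_arcsin (by linarith) ((div_le_one hx0).2 (by linarith))

theorem sin_arcsin_inv {x : ℝ} (hx : 1 ≤ x) :
    Real.sin (Real.arcsin (1 / (2 * x))) = 1 / (2 * x) := by
  have : 0 ≤ 1 / (2 * x) := by positivity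
  exact Real.sin_arcsin (by linarith) ((div_le_one (by linarith)).2 (by linarith))

theorem arcsin_half : Real.arcsin (1 / 2) = Real.pi / 6 := by
  rw [← Real.sin_pi_div_six, Real.arcsin_sin] <;> linarith [Real.pi_pos]

theorem arcsin_inv_mem {x : ℝ} (hx : 1 ≤ x) :
    0 < Real.arcsin (1 / (2 * x)) ∧ Real.arcsin (1 / (2 * x)) ≤ Real.pi / 6 := by
  refine ⟨Real.arcsin_pos.2 (by positivity), ?_⟩
  rw [← arcsin_half]
  exact Real.monotone_arcsin (one_div_le_one_div_of_le (by norm_num) (by linarith))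

theorem mul_cos_arcsin_div {c x : ℝ} (hx : 0 < x) :
    x * Real.cos (Real.arcsin (c / x)) = √(x ^ 2 - c ^ 2) := by
  rw [Real.cos_arcsin, ← Real.sqrt_sq hx.le, ← Real.sqrt_mul (sq_nonneg _), Real.sqrt_sq hx.le]
  congr 1
  field_simp

/-- The addition theorem. For `θ = arcsin (1 / (2x))` one has `2x³ sin 3θ = 3x² - 1` and `2x³ cos 3θ
= (x² - 1) √(4x² - 1)`, which are the coefficients in `triF`. -/
theorem triF_eq {α β γ x : ℝ} (hα : 0 ≤ Real.cos α) (hβ : 0 ≤ Real.cos β) (hx : 1 ≤ x) :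
    triF α β γ x = 2 * x ^ 5 * (Real.cos γ / x -
      Real.sin (Real.arcsin (Real.cos α / x) + Real.arcsin (Real.cos β / x) +
        3 * Real.arcsin (1 / (2 * x)))) := by
  have hx0 : 0 < x := by linarith
  have h1 := mul_cos_arcsin_div (c := Real.cos α) hx0
  have h2 := mul_cos_arcsin_div (c := Real.cos β) hx0
  have h3 : 2 * x * Real.cos (Real.arcsin (1 / (2 * x))) = √(4 * x ^ 2 - 1) := by
    rw [mul_cos_arcsin_div (by linarith : 0 < 2 * x)]; ring_nf
  have s1 : x * Real.sin (Real.arcsin (Real.cos α / x)) = Real.cos α := by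
    rw [sin_arcsin_div hα (Real.cos_le_one _) hx]; field_simp
  have s2 : x * Real.sin (Real.arcsin (Real.cos β / x)) = Real.cos β := by
    rw [sin_arcsin_div hβ (Real.cos_le_one _) hx]; field_simp
  have s3 : 2 * x * Real.sin (Real.arcsin (1 / (2 * x))) = 1 := by
    rw [sin_arcsin_inv hx]; field_simp
  have p3 := Real.sin_sq_add_cos_sq (Real.arcsin (1 / (2 * x)))
  have e0 : 2 * x ^ 5 * (Real.cos γ / x) = 2 * x ^ 4 * Real.cos γ := by field_simp
  rw [mul_sub, e0, Real.sin_add, Real.sin_add, Real.cos_add, Real.sin_three_mul,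
    Real.cos_three_mul, triF, ← h1, ← h2, ← h3]
  generalize Real.sin (Real.arcsin (1 / (2 * x))) = sh at *
  generalize Real.cos (Real.arcsin (1 / (2 * x))) = ch at *
  generalize Real.cos (Real.arcsin (Real.cos α / x)) = ca at *
  generalize Real.cos (Real.arcsin (Real.cos β / x)) = cb at *
  generalize Real.sin (Real.arcsin (Real.cos α / x)) = sa at *
  generalize Real.sin (Real.arcsin (Real.cos β / x)) = sb at *
  rw [← s1, ← s2]
  have t1 : 2 * x ^ 3 * (3 * sh - 4 * sh ^ 3) = 3 * x ^ 2 - 1 := by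
    linear_combination (3 * x ^ 2 - ((2 * x * sh) ^ 2 + 2 * x * sh + 1)) * s3
  have t2 : 2 * x ^ 3 * (4 * ch ^ 3 - 3 * ch) = (x ^ 2 - 1) * (2 * x * ch) := by
    have : ch ^ 2 = 1 - sh ^ 2 := by linarith
    linear_combination 8 * x ^ 3 * ch * this - 2 * x * ch * (2 * x * sh + 1) * s3
  linear_combination (x ^ 2 * (sa * sb - ca * cb)) * -t1 + x ^ 2 * (sa * cb + ca * sb) * t2

theorem sin_sub_sin_sign {s c : ℝ} (hcs : c < s) (hs : s - c < 2 * Real.pi)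
    (hsc0 : 0 ≤ s + c) (hsc : s + c ≤ 2 * Real.pi) :
    (0 < Real.sin c - Real.sin s ↔ Real.pi < s + c) ∧
      (Real.sin c - Real.sin s < 0 ↔ s + c < Real.pi) := by
  have hpi := Real.pi_pos
  have h1 : 0 < Real.sin ((s - c) / 2) := Real.sin_pos_of_pos_of_lt_pi (by linarith) (by linarith)
  have h2 : Real.sin c - Real.sin s = 2 * Real.sin ((s - c) / 2) * -Real.cos ((s + c) / 2) := by
    rw [← neg_sub, Real.sin_sub_sin]; ring
  have h3 : Real.cos ((s + c) / 2) < 0 ↔ Real.pi < s + c := by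
    constructor
    · intro h
      by_contra hle
      exact absurd (Real.cos_nonneg_of_neg_pi_div_two_le_of_le (by linarith) (by linarith)) h.not_ge
    · intro h
      exact Real.cos_neg_of_pi_div_two_lt_of_lt (by linarith) (by linarith)
  have h4 : 0 < Real.cos ((s + c) / 2) ↔ s + c < Real.pi := by
    constructor
    · intro h
      by_contra hle
      exact absurd (Real.cos_nonpos_of_pi_div_two_le_of_le (by linarith) (by linarith)) h.not_ge
    · intro h
      exact Real.cos_pos_of_mem_Ioo ⟨by linarith, by linarith⟩
  rw [h2, ← h3, ← h4, mul_pos_iff_of_pos_left (by linarith), neg_pos]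
  refine ⟨Iff.rfl, ?_⟩
  rw [mul_neg, neg_lt_zero, mul_pos_iff_of_pos_left (by linarith)]

theorem triF_sign {α β γ x : ℝ} (hα : α ∈ Set.Icc 0 (Real.pi / 2))
    (hβ : β ∈ Set.Icc 0 (Real.pi / 2)) (hγ : γ ∈ Set.Icc 0 (Real.pi / 2))
    (hsum : α + β + γ < Real.pi) (hx : 1 ≤ x) :
    (0 < triF α β γ x ↔ Real.pi < halfAngle α β γ x) ∧
      (triF α β γ x < 0 ↔ halfAngle α β γ x < Real.pi) := by
  have hx0 : 0 < x := by linarith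
  have hpi := Real.pi_pos
  have ca := cos_nonneg_of_mem hα
  have cb := cos_nonneg_of_mem hβ
  have cc := cos_nonneg_of_mem hγ
  obtain ⟨a0, a1⟩ := arcsin_div_mem ca hx0
  obtain ⟨b0, b1⟩ := arcsin_div_mem cb hx0
  obtain ⟨c0, c1⟩ := arcsin_div_mem cc hx0
  obtain ⟨h0, h1⟩ := arcsin_inv_mem hx
  -- `sin 3θ - 1/x = (x² - 1) / (2x³)` is nonnegative. Together with `hab` it gives the strict
  -- inequality that `sin_sub_sin_sign` needs.
  have hch : Real.arcsin (Real.cos γ / x) ≤ 3 * Real.arcsin (1 / (2 * x)) := by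
    rw [Real.arcsin_le_iff_le_sin ⟨by linarith [div_nonneg cc hx0.le],
      (div_le_one hx0).2 ((Real.cos_le_one _).trans hx)⟩ ⟨by linarith, by linarith⟩,
      Real.sin_three_mul,
      sin_arcsin_inv hx]
    have : Real.cos γ / x ≤ 1 / x := by gcongr; exact Real.cos_le_one _
    refine this.trans ?_
    rw [← sub_nonneg]
    have e : 3 * (1 / (2 * x)) - 4 * (1 / (2 * x)) ^ 3 - 1 / x = (x ^ 2 - 1) / (2 * x ^ 3) := by
      field_simp; ring
    rw [e]
    have : 0 ≤ x ^ 2 - 1 := by nlinarith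
    positivity
  -- Both terms vanish only if `α = β = π/2`, which the bound on the angle sum excludes.
  have hab : 0 < Real.arcsin (Real.cos α / x) + Real.arcsin (Real.cos β / x) := by
    by_contra hneg
    have ea : Real.arcsin (Real.cos α / x) = 0 := by linarith
    have eb : Real.arcsin (Real.cos β / x) = 0 := by linarith
    rw [Real.arcsin_eq_zero_iff, div_eq_zero_iff, or_iff_left hx0.ne'] at ea eb
    have hα' : α = Real.pi / 2 := Real.injOn_cos ⟨hα.1, by linarith [hα.2]⟩
      ⟨by linarith, by linarith⟩ (by rw [ea, Real.cos_pi_div_two])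
    have hβ' : β = Real.pi / 2 := Real.injOn_cos ⟨hβ.1, by linarith [hβ.2]⟩
      ⟨by linarith, by linarith⟩ (by rw [eb, Real.cos_pi_div_two])
    linarith [hγ.1]
  have key := sin_sub_sin_sign (s := Real.arcsin (Real.cos α / x) + Real.arcsin (Real.cos β / x) +
        3 * Real.arcsin (1 / (2 * x))) (c := Real.arcsin (Real.cos γ / x)) (by linarith)
    (by linarith) (by linarith) (by linarith)
  rw [sin_arcsin_div cc (Real.cos_le_one _) hx] at key
  have e : Real.arcsin (Real.cos α / x) + Real.arcsin (Real.cos β / x) +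
        3 * Real.arcsin (1 / (2 * x)) + Real.arcsin (Real.cos γ / x) = halfAngle α β γ x := by
    unfold halfAngle; ring
  rw [e] at key
  have hx5 : 0 < 2 * x ^ 5 := by positivity
  rw [triF_eq ca cb hx, ← key.1, ← key.2, mul_pos_iff_of_pos_left hx5]
  refine ⟨Iff.rfl, ?_⟩
  rw [← neg_pos, ← mul_neg, mul_pos_iff_of_pos_left hx5, neg_pos]

theorem halfAngle_strictAntiOn {α β γ : ℝ} (hα : 0 ≤ Real.cos α) (hβ : 0 ≤ Real.cos β)
    (hγ : 0 ≤ Real.cos γ) : StrictAntiOn (halfAngle α β γ) (Set.Ici 1) := by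
  intro x hx y hy hxy
  simp only [Set.mem_Ici] at hx hy
  have hx0 : 0 < x := by linarith
  have mono : ∀ c : ℝ, 0 ≤ c → Real.arcsin (c / y) ≤ Real.arcsin (c / x) := fun c hc =>
    Real.monotone_arcsin (div_le_div_of_nonneg_left hc hx0 hxy.le)
  have hx1 : 1 / (2 * x) ≤ 1 := (div_le_one (by linarith)).2 (by linarith)
  have hlt : 1 / (2 * y) < 1 / (2 * x) := one_div_lt_one_div_of_lt (by linarith) (by linarith)
  have hy0 : 0 < 1 / (2 * y) := by have : 0 < y := by linarith
                                   positivity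
  have strict : Real.arcsin (1 / (2 * y)) < Real.arcsin (1 / (2 * x)) :=
    Real.strictMonoOn_arcsin ⟨by linarith, by linarith⟩ ⟨by linarith, hx1⟩ hlt
  unfold halfAngle
  linarith [mono _ hα, mono _ hβ, mono _ hγ]

theorem exists_halfAngle_eq_pi {α β γ : ℝ} (hα : α ∈ Set.Icc 0 (Real.pi / 2))
    (hβ : β ∈ Set.Icc 0 (Real.pi / 2)) (hγ : γ ∈ Set.Icc 0 (Real.pi / 2))
    (hsum : α + β + γ < Real.pi) : ∃ x, 1 < x ∧ halfAngle α β γ x = Real.pi := by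
  have harc : ∀ a ∈ Set.Icc 0 (Real.pi / 2), Real.arcsin (Real.cos a / 1) = Real.pi / 2 - a := by
    intro a ha
    rw [div_one, ← Real.sin_pi_div_two_sub, Real.arcsin_sin] <;> linarith [ha.1, ha.2]
  -- The value at `1` is `2π - (α + β + γ)`.
  have h1 : Real.pi < halfAngle α β γ 1 := by
    unfold halfAngle
    rw [harc α hα, harc β hβ, harc γ hγ, mul_one, arcsin_half]
    linarith
  have hle : ∀ a, Real.arcsin (Real.cos a / 2) ≤ Real.pi / 6 := by
    intro a
    rw [← arcsin_half]
    exact Real.monotone_arcsin (by linarith [Real.cos_le_one a])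
  have h2 : halfAngle α β γ 2 < Real.pi := by
    have : Real.arcsin (1 / (2 * 2)) < Real.pi / 6 := by
      rw [← arcsin_half]
      exact Real.strictMonoOn_arcsin ⟨by norm_num, by norm_num⟩ ⟨by norm_num, by norm_num⟩
        (by norm_num)
    unfold halfAngle
    linarith [hle α, hle β, hle γ]
  have hcont : ContinuousOn (halfAngle α β γ) (Set.Icc 1 2) := by
    unfold halfAngle
    have hne : ∀ x ∈ Set.Icc (1 : ℝ) 2, x ≠ 0 := fun x hx => by linarith [hx.1]
    have hne' : ∀ x ∈ Set.Icc (1 : ℝ) 2, 2 * x ≠ 0 := fun x hx => by linarith [hx.1]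
    have hc : ∀ c : ℝ, ContinuousOn (fun x => Real.arcsin (c / x)) (Set.Icc 1 2) := fun c =>
      Real.continuous_arcsin.comp_continuousOn (continuousOn_const.div continuousOn_id hne)
    have hc' : ContinuousOn (fun x => Real.arcsin (1 / (2 * x))) (Set.Icc 1 2) :=
      Real.continuous_arcsin.comp_continuousOn
        (continuousOn_const.div (continuousOn_const.mul continuousOn_id) hne')
    exact (((hc _).add (hc _)).add (hc _)).add (continuousOn_const.mul hc')
  obtain ⟨x, hx, hx'⟩ := intermediate_value_Icc' (by norm_num : (1 : ℝ) ≤ 2) hcont ⟨h2.le, h1.le⟩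
  refine ⟨x, lt_of_le_of_ne hx.1 ?_, hx'⟩
  rintro rfl
  exact h1.ne' hx'

/-! ### The centre of the maximal disk -/

/-- Here `p, q, r` and `k, l, m` are the sines and cosines of three angles with sum `π`. The
adjugate entries at the sines share a common factor, which makes the Gram condition on the heights
solvable by scaling. -/
theorem gramAdj_sin {p q r k l m y : ℝ} (hpk : p ^ 2 + k ^ 2 = 1) (hm : m = p * q - k * l)
    (hl : l = r * p - m * k) (hp : p = q * m + l * r) (hq : q = r * k + m * p)
    (hr : r = p * l + k * q) :
    gramAdj (y * p - k / 2) (y * q - l / 2) (y * r - m / 2) p q r =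
      (y * k + p / 2) * (p * (y * k + p / 2) + q * (y * l + q / 2) + r * (y * m + r / 2)) := by
  unfold gramAdj
  linear_combination -p * (y ^ 2 + 1 / 4) * hpk - q * (y ^ 2 - 1 / 4) * hm + q * y * hr -
    r * (y ^ 2 - 1 / 4) * hl + r * y * hq - (y ^ 2 - 3 / 4) * hp

/-- The heights of the centre of the maximal disk over the sides. -/
theorem exists_heights {A B C a b c x y : ℝ} (hx : 1 < x) (hABC : A + B + C = Real.pi)
    (hA : 0 < A) (hB : 0 < B) (hC : 0 < C) (hy : y ^ 2 = x ^ 2 - 1 / 4)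
    (ha : a = y * Real.sin A - Real.cos A / 2) (hb : b = y * Real.sin B - Real.cos B / 2)
    (hc : c = y * Real.sin C - Real.cos C / 2) (ha0 : 0 ≤ a) :
    ∃ u v w, 0 < u ∧ 0 < v ∧ 0 < w ∧
      gramAdj a b c u v w * u + gramAdj b c a v w u * v + gramAdj c a b w u v * w =
        gramDet a b c ∧
      v ^ 2 + w ^ 2 + 2 * v * w * a = x ^ 2 - 1 ∧ w ^ 2 + u ^ 2 + 2 * w * u * b = x ^ 2 - 1 ∧
      u ^ 2 + v ^ 2 + 2 * u * v * c = x ^ 2 - 1 := by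
  have sA : 0 < Real.sin A := Real.sin_pos_of_pos_of_lt_pi hA (by linarith)
  have sB : 0 < Real.sin B := Real.sin_pos_of_pos_of_lt_pi hB (by linarith)
  have sC : 0 < Real.sin C := Real.sin_pos_of_pos_of_lt_pi hC (by linarith)
  have pA := Real.sin_sq_add_cos_sq A
  have pB := Real.sin_sq_add_cos_sq B
  have pC := Real.sin_sq_add_cos_sq C
  have add : ∀ {X Y Z : ℝ}, X + Y + Z = Real.pi →
      Real.sin Z = Real.sin X * Real.cos Y + Real.cos X * Real.sin Y ∧
      Real.cos Z = Real.sin X * Real.sin Y - Real.cos X * Real.cos Y := by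
    intro X Y Z h
    obtain rfl : Z = Real.pi - (X + Y) := by linarith
    rw [Real.sin_pi_sub, Real.sin_add, Real.cos_pi_sub, Real.cos_add]
    exact ⟨rfl, by ring⟩
  obtain ⟨hr, hm⟩ := add hABC
  obtain ⟨hp, hk⟩ := add (by linarith : B + C + A = Real.pi)
  obtain ⟨hq, hl⟩ := add (by linarith : C + A + B = Real.pi)
  generalize Real.sin A = p at *
  generalize Real.sin B = q at *
  generalize Real.sin C = r at *
  generalize Real.cos A = k at *
  generalize Real.cos B = l at *
  generalize Real.cos C = m at *
  -- The sines are the sides of a triangle with angles `A, B, C`. By the law of cosines the three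
  -- quadratic forms have the same, symmetric value `N`.
  obtain ⟨N, hN⟩ : ∃ N, N = (p ^ 2 + q ^ 2 + r ^ 2) / 2 + 2 * y * (p * q * r) := ⟨_, rfl⟩
  obtain ⟨E, hE⟩ : ∃ E, E = p * (y * k + p / 2) + q * (y * l + q / 2) + r * (y * m + r / 2) :=
    ⟨_, rfl⟩
  have q₀ : q ^ 2 + r ^ 2 + 2 * q * r * a = N := by
    rw [hN, ha]; linear_combination -(1 / 2) * (p * hp - q * hq - r * hr)
  have q₁ : r ^ 2 + p ^ 2 + 2 * r * p * b = N := by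
    rw [hN, hb]; linear_combination -(1 / 2) * (q * hq - r * hr - p * hp)
  have q₂ : p ^ 2 + q ^ 2 + 2 * p * q * c = N := by
    rw [hN, hc]; linear_combination -(1 / 2) * (r * hr - p * hp - q * hq)
  have κ₀ : gramAdj a b c p q r = (y * k + p / 2) * E := by
    rw [ha, hb, hc, gramAdj_sin pA hm hl (by linarith) (by linarith) (by linarith), hE]
  have κ₁ : gramAdj b c a q r p = (y * l + q / 2) * E := by
    rw [ha, hb, hc, gramAdj_sin pB hk hm (by linarith) (by linarith) (by linarith), hE]; ring
  have κ₂ : gramAdj c a b r p q = (y * m + r / 2) * E := by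
    rw [ha, hb, hc, gramAdj_sin pC hl hk (by linarith) (by linarith) (by linarith), hE]; ring
  have hW : gramAdj a b c p q r * p + gramAdj b c a q r p * q + gramAdj c a b r p q * r =
      E ^ 2 := by
    rw [κ₀, κ₁, κ₂]; linear_combination -E * hE
  -- `gramAdj_sq` at the sines reads `(x² - a²) E² = (1 - a²) E² + gramDet * N`. So the scale that
  -- makes the forms `x² - 1` also makes the point a unit vector.
  have hDN : gramDet a b c * N = E ^ 2 * (x ^ 2 - 1) := by
    have := gramAdj_sq a b c p q r
    rw [hW, q₀, κ₀] at this
    have e : (y * k + p / 2) ^ 2 + a ^ 2 = x ^ 2 := by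
      rw [ha]; linear_combination (y ^ 2 + 1 / 4) * pA + hy
    linear_combination -this + E ^ 2 * e
  have hs : 0 < x ^ 2 - 1 := by nlinarith
  have hN0 : 0 < N := by rw [← q₀]; positivity
  obtain ⟨t, ht, ht'⟩ : ∃ t, 0 < t ∧ t ^ 2 * N = x ^ 2 - 1 := by
    refine ⟨√((x ^ 2 - 1) / N), by positivity, ?_⟩
    rw [Real.sq_sqrt (by positivity)]
    field_simp
  refine ⟨t * p, t * q, t * r, by positivity, by positivity, by positivity, ?_, ?_, ?_, ?_⟩
  · have e : gramDet a b c = t ^ 2 * E ^ 2 := by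
      refine mul_right_cancel₀ hN0.ne' ?_
      rw [hDN, ← ht']; ring
    rw [e, ← hW]
    simp only [gramAdj]; ring
  · linear_combination t ^ 2 * q₀ + ht'
  · linear_combination t ^ 2 * q₁ + ht'
  · linear_combination t ^ 2 * q₂ + ht'

theorem exists_sharp_point {α β γ x : ℝ} (T : HypTriangle α β γ)
    (hα : α ∈ Set.Icc 0 (Real.pi / 2)) (hβ : β ∈ Set.Icc 0 (Real.pi / 2))
    (hγ : γ ∈ Set.Icc 0 (Real.pi / 2)) (hsum : α + β + γ < Real.pi) (hx : 1 < x)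
    (h : halfAngle α β γ x = Real.pi) :
    ∃ o : ℍ, (∀ k, 0 < (T.side k).ht o) ∧
      ∀ i j, i ≠ j → dist ((T.side i).refl o) ((T.side j).refl o) = 2 * Real.arcosh x := by
  have hx0 : 0 < x := by linarith
  have ca := cos_nonneg_of_mem hα
  have cb := cos_nonneg_of_mem hβ
  have cc := cos_nonneg_of_mem hγ
  have h0 := (arcsin_inv_mem hx.le).1
  have hs := sin_arcsin_inv hx.le
  have hsq := Real.sin_sq_add_cos_sq (Real.arcsin (1 / (2 * x)))
  -- With `θ = arcsin (1 / (2x))` and `A = arcsin (c/x) + θ`, expand `c = x sin (A - θ)` using `x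
  -- sin θ = 1/2`. The three angles `A` add up to `halfAngle`.
  have hang : ∀ c : ℝ, 0 ≤ c → c ≤ 1 → 0 < Real.arcsin (c / x) + Real.arcsin (1 / (2 * x)) ∧
      c = x * Real.cos (Real.arcsin (1 / (2 * x))) *
        Real.sin (Real.arcsin (c / x) + Real.arcsin (1 / (2 * x))) -
        Real.cos (Real.arcsin (c / x) + Real.arcsin (1 / (2 * x))) / 2 := by
    intro c hc hc1
    refine ⟨by linarith [(arcsin_div_mem hc hx0).1], ?_⟩
    have e1 := sin_arcsin_div hc hc1 hx.le
    have e2 := Real.sin_sub (Real.arcsin (c / x) + Real.arcsin (1 / (2 * x)))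
      (Real.arcsin (1 / (2 * x)))
    rw [add_sub_cancel_right, e1, hs, div_eq_iff hx0.ne'] at e2
    have e3 : x * (1 / (2 * x)) = 1 / 2 := by field_simp
    linear_combination e2 - Real.cos (Real.arcsin (c / x) + Real.arcsin (1 / (2 * x))) * e3
  obtain ⟨hA, ea⟩ := hang _ ca (Real.cos_le_one _)
  obtain ⟨hB, eb⟩ := hang _ cb (Real.cos_le_one _)
  obtain ⟨hC, ec⟩ := hang _ cc (Real.cos_le_one _)
  have hy : (x * Real.cos (Real.arcsin (1 / (2 * x)))) ^ 2 = x ^ 2 - 1 / 4 := by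
    rw [hs] at hsq
    rw [mul_pow, ← sub_eq_iff_eq_add'.2 hsq.symm]
    field_simp
    ring
  obtain ⟨u, v, w, hu, hv, hw, hdet, k₀, k₁, k₂⟩ := exists_heights hx
    (by rw [← h]; unfold halfAngle; ring) hA hB hC hy ea eb ec ca
  obtain ⟨o, rfl, rfl, rfl⟩ := T.exists_of_ht hα hβ hγ hsum hu hv hw hdet
  obtain ⟨pa, pb, pc⟩ := T.lor_normal_sides
  rw [HypHalfPlane.lor_normal] at pa pb pc
  have conv : ∀ {H K : HypHalfPlane}, Real.sinh (dist (H.refl o) (K.refl o) / 2) ^ 2 =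
      x ^ 2 - 1 → dist (H.refl o) (K.refl o) = 2 * Real.arcosh x := by
    intro H K hHK
    have e := Real.cosh_sq (dist (H.refl o) (K.refl o) / 2)
    rw [hHK, sub_add_cancel, pow_left_inj₀ (Real.cosh_pos _).le hx0.le two_ne_zero] at e
    rw [← e, Real.arcosh_cosh (by positivity)]
    ring
  have d₀ := conv (H := T.side 1) (K := T.side 2) (by
    rw [HypHalfPlane.sinh_half_dist_refl_sq]; linear_combination k₀ -
      2 * (T.side 1).ht o * (T.side 2).ht o * pa.symm)
  have d₁ := conv (H := T.side 2) (K := T.side 0) (by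
    rw [HypHalfPlane.sinh_half_dist_refl_sq]; linear_combination k₁ -
      2 * (T.side 2).ht o * (T.side 0).ht o * pb.symm)
  have d₂ := conv (H := T.side 0) (K := T.side 1) (by
    rw [HypHalfPlane.sinh_half_dist_refl_sq]; linear_combination k₂ -
      2 * (T.side 0).ht o * (T.side 1).ht o * pc.symm)
  refine ⟨o, fun k => ?_, fun i j hij => ?_⟩
  · fin_cases k <;> assumption
  · fin_cases i <;> fin_cases j <;>
      first
        | exact absurd rfl hij
        | assumption
        | (rw [dist_comm]; assumption)

/-! ### The injectivity radius of the surface -/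

namespace HypTriangle

variable {α β γ : ℝ} {T : HypTriangle α β γ}

theorem Nonobtuse.exists_injRadius (hT : T.Nonobtuse) (hint : ∃ o, ∀ k, 0 < (T.side k).ht o)
    (b : Bool) {p : ℍ} (hp : p ∈ T.carrier) :
    IsGreatest (embeddedRadii (T.emb b p)) (injRadius (T.emb b p)) ∧
      (∀ i j, i ≠ j →
        2 * injRadius (T.emb b p) ≤ dist ((T.side i).refl p) ((T.side j).refl p)) ∧
      ∃ i j, i ≠ j ∧ dist ((T.side i).refl p) ((T.side j).refl p) =
        2 * injRadius (T.emb b p) := by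
  have : Nonempty {ij : Fin 3 × Fin 3 // ij.1 ≠ ij.2} := ⟨⟨(0, 1), by decide⟩⟩
  obtain ⟨⟨⟨i, j⟩, hij⟩, hmin⟩ := Finite.exists_min
    fun ij : {ij : Fin 3 × Fin 3 // ij.1 ≠ ij.2} =>
      dist ((T.side ij.1.1).refl p) ((T.side ij.1.2).refl p)
  have hg : IsGreatest (embeddedRadii (T.emb b p))
      (dist ((T.side i).refl p) ((T.side j).refl p) / 2) := by
    refine ⟨⟨by positivity, hT.isEmbeddedDisk_emb b hp fun i' j' h => ?_⟩, fun r hr => ?_⟩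
    · rw [mul_div_cancel₀ _ two_ne_zero]
      exact hmin ⟨(i', j'), h⟩
    · linarith [hT.two_mul_le_of_isEmbeddedDisk hint hp hr.2 hij]
  have e : injRadius (T.emb b p) = dist ((T.side i).refl p) ((T.side j).refl p) / 2 := hg.csSup_eq
  refine ⟨by rwa [e], fun i' j' h => ?_, i, j, hij, by rw [e]; ring⟩
  rw [e, mul_div_cancel₀ _ two_ne_zero]
  exact hmin ⟨(i', j'), h⟩

/-- At the centre all mirror images are `2 * Real.arcosh x` apart, and at any other point some pair
is no farther apart than that. -/
theorem maxInjRadius_eq {x : ℝ} (hα : α ∈ Set.Icc 0 (Real.pi / 2))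
    (hβ : β ∈ Set.Icc 0 (Real.pi / 2)) (hγ : γ ∈ Set.Icc 0 (Real.pi / 2))
    (hsum : α + β + γ < Real.pi) (hx : 1 < x) (h : halfAngle α β γ x = Real.pi) :
    (∀ p : T.Surface, IsGreatest (embeddedRadii p) (injRadius p)) ∧
      IsGreatest (Set.range (injRadius : T.Surface → ℝ)) (maxInjRadius T.Surface) ∧
      maxInjRadius T.Surface = Real.arcosh x := by
  have hT : T.Nonobtuse := nonobtuse_of_cos_nonneg (cos_nonneg_of_mem hα) (cos_nonneg_of_mem hβ)
    (cos_nonneg_of_mem hγ)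
  obtain ⟨o, ho, hod⟩ := exists_sharp_point T hα hβ hγ hsum hx h
  have hoT : o ∈ T.carrier := T.mem_carrier_iff.2 fun k => (ho k).le
  have hg : IsGreatest (Set.range (injRadius : T.Surface → ℝ)) (Real.arcosh x) := by
    constructor
    · obtain ⟨-, -, i, j, hij, he⟩ := hT.exists_injRadius ⟨o, ho⟩ true hoT
      exact ⟨T.emb true o, by linarith [hod i j hij]⟩
    · rintro _ ⟨y, rfl⟩
      obtain ⟨b, p, hp, rfl⟩ := T.exists_emb y
      obtain ⟨-, hle, -⟩ := hT.exists_injRadius ⟨o, ho⟩ b hp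
      obtain ⟨i, j, hij, hpo⟩ := exists_dist_refl_le hα hβ hγ hsum (o := o) hp
      linarith [hle i j hij, hod i j hij]
  have e : maxInjRadius T.Surface = Real.arcosh x := hg.csSup_eq
  refine ⟨fun y => ?_, by rwa [e], e⟩
  obtain ⟨b, p, hp, rfl⟩ := T.exists_emb y
  exact (hT.exists_injRadius ⟨o, ho⟩ b hp).1

end HypTriangle

/-! ### The trigonometric system and the main theorem -/

theorem existsUnique_solvesSystem {α β γ x : ℝ} (hα : 0 ≤ Real.cos α) (hβ : 0 ≤ Real.cos β)
    (hγ : 0 ≤ Real.cos γ) (hx : 1 < x) (h : halfAngle α β γ x = Real.pi)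
    (hzero : ∀ r, 0 < r → (triFcosh α β γ r = 0 ↔ r = Real.arcosh x)) :
    ∃! s : TrigUnknowns, SolvesSystem α β γ s ∧ s.Admissible := by
  have hx0 : 0 < x := by linarith
  have hR : 0 < Real.arcosh x := Real.arcosh_pos hx
  have hch : Real.cosh (Real.arcosh x) = x := Real.cosh_arcosh hx.le
  have hlt : ∀ c : ℝ, c ≤ 1 → Real.arcsin (c / x) < Real.pi / 2 := fun c hc =>
    Real.arcsin_lt_pi_div_two.2 ((div_lt_one hx0).2 (by linarith))
  have hnn : ∀ c : ℝ, 0 ≤ c → 0 ≤ Real.arcsin (c / x) := fun c hc => (arcsin_div_mem hc hx0).1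
  have hϑ : Real.arcsin (1 / (2 * x)) < Real.pi / 6 := by
    have h1 : 0 < 1 / (2 * x) := by positivity
    rw [← arcsin_half]
    exact Real.strictMonoOn_arcsin ⟨by linarith, (div_le_one (by linarith)).2 (by linarith)⟩
      ⟨by norm_num, by norm_num⟩ (one_div_lt_one_div_of_lt (by norm_num) (by linarith))
  have hϑ0 := (arcsin_inv_mem hx.le).1
  have hcosϑ : Real.cos (2 * Real.arcsin (1 / (2 * x))) = 1 - 1 / (2 * x ^ 2) := by
    rw [Real.cos_two_mul, Real.cos_sq', sin_arcsin_inv hx.le]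
    field_simp
    ring
  unfold halfAngle at h
  refine ⟨⟨Real.arcosh x, 2 * Real.arcsin (Real.cos α / x), 2 * Real.arcsin (Real.cos β / x),
    2 * Real.arcsin (Real.cos γ / x), 2 * Real.arcsin (1 / (2 * x))⟩, ⟨⟨?_, ?_, ?_, ?_, ?_⟩,
    ⟨hR, ?_, ?_, ?_, ?_⟩⟩, ?_⟩
  · simp only [hch]
    rw [mul_div_cancel_left₀ _ two_ne_zero, sin_arcsin_div hα (Real.cos_le_one _) hx.le]
  · simp only [hch]
    rw [mul_div_cancel_left₀ _ two_ne_zero, sin_arcsin_div hβ (Real.cos_le_one _) hx.le]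
  · simp only [hch]
    exact hcosϑ
  · simp only; linarith
  · exact (hzero _ hR).2 rfl
  · exact ⟨by linarith [hnn _ hα], by linarith [hlt _ (Real.cos_le_one α)]⟩
  · exact ⟨by linarith [hnn _ hβ], by linarith [hlt _ (Real.cos_le_one β)]⟩
  · exact ⟨by linarith [hnn _ hγ], by linarith [hlt _ (Real.cos_le_one γ)]⟩
  · exact ⟨by linarith, by linarith⟩
  · rintro ⟨r, a, b, c, t⟩ ⟨⟨ea, eb, et, ec, eF⟩, ⟨hr, ha, hb, hc, ht⟩⟩
    simp only at ea eb et ec eF hr ha hb hc ht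
    obtain rfl := (hzero r hr).1 eF
    rw [hch] at ea eb et
    have ea' : a = 2 * Real.arcsin (Real.cos α / x) := by
      rw [← ea, Real.arcsin_sin] <;> linarith [ha.1, ha.2]
    have eb' : b = 2 * Real.arcsin (Real.cos β / x) := by
      rw [← eb, Real.arcsin_sin] <;> linarith [hb.1, hb.2]
    have et' : t = 2 * Real.arcsin (1 / (2 * x)) := by
      refine Real.injOn_cos ⟨ht.1.le, by linarith [ht.2, Real.pi_pos]⟩
        ⟨by linarith, by linarith⟩ ?_
      rw [et, hcosϑ]
    -- The third angle gets the same form as the other two because `halfAngle` equals `π`.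
    have ec' : c = 2 * Real.arcsin (Real.cos γ / x) := by
      rw [ec, ea', eb', et']; linarith
    rw [ea', eb', ec', et']

theorem mainTheorem9 (α β γ : ℝ)
    (hα : α ∈ Set.Icc 0 (Real.pi / 2)) (hβ : β ∈ Set.Icc 0 (Real.pi / 2))
    (hγ : γ ∈ Set.Icc 0 (Real.pi / 2)) (hsum : α + β + γ < Real.pi) :
    (∃! s : TrigUnknowns, SolvesSystem α β γ s ∧ s.Admissible) ∧
    ∀ T : HypTriangle α β γ,
      -- the maxima in the definition of the maximum injectivity radius are attained
      (∀ p : T.Surface, IsGreatest (embeddedRadii p) (injRadius p)) ∧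
      IsGreatest (Set.range (injRadius : T.Surface → ℝ)) (maxInjRadius T.Surface) ∧
      -- the maximum injectivity radius is the unique positive zero of `F`
      0 < maxInjRadius T.Surface ∧
      (∀ r : ℝ, 0 < r → (triFcosh α β γ r = 0 ↔ r = maxInjRadius T.Surface)) ∧
      (∀ r : ℝ, 0 ≤ r →
        (0 < triFcosh α β γ r ↔ r < maxInjRadius T.Surface) ∧
        (triFcosh α β γ r < 0 ↔ maxInjRadius T.Surface < r)) := by
  have ca := cos_nonneg_of_mem hα
  have cb := cos_nonneg_of_mem hβ
  have cc := cos_nonneg_of_mem hγ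
  obtain ⟨x, hx, hxπ⟩ := exists_halfAngle_eq_pi hα hβ hγ hsum
  have hR : 0 < Real.arcosh x := Real.arcosh_pos hx
  have hch : Real.cosh (Real.arcosh x) = x := Real.cosh_arcosh hx.le
  have hanti := halfAngle_strictAntiOn ca cb cc
  have hsign : ∀ r, 0 ≤ r → (0 < triFcosh α β γ r ↔ r < Real.arcosh x) ∧
      (triFcosh α β γ r < 0 ↔ Real.arcosh x < r) := by
    intro r hr
    obtain ⟨h1, h2⟩ := triF_sign hα hβ hγ hsum (Real.one_le_cosh r)
    have e1 : r < Real.arcosh x ↔ Real.cosh r < x := by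
      conv_rhs => rw [← hch]
      rw [Real.cosh_lt_cosh, abs_of_nonneg hr, abs_of_pos hR]
    have e2 : Real.arcosh x < r ↔ x < Real.cosh r := by
      conv_rhs => rw [← hch]
      rw [Real.cosh_lt_cosh, abs_of_nonneg hr, abs_of_pos hR]
    rw [triFcosh, h1, h2, e1, e2, ← hxπ]
    exact ⟨hanti.lt_iff_gt hx.le (Real.one_le_cosh r), hanti.lt_iff_gt (Real.one_le_cosh r) hx.le⟩
  have hzero : ∀ r, 0 < r → (triFcosh α β γ r = 0 ↔ r = Real.arcosh x) := by
    intro r hr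
    obtain ⟨h1, h2⟩ := hsign r hr.le
    constructor
    · intro h
      rw [h] at h1 h2
      exact le_antisymm (not_lt.1 fun h' => lt_irrefl _ (h2.2 h'))
        (not_lt.1 fun h' => lt_irrefl _ (h1.2 h'))
    · rintro rfl
      exact le_antisymm (not_lt.1 fun h' => lt_irrefl _ (h1.1 h'))
        (not_lt.1 fun h' => lt_irrefl _ (h2.1 h'))
  refine ⟨existsUnique_solvesSystem ca cb cc hx hxπ hzero, fun T => ?_⟩
  obtain ⟨hinj, hmax, he⟩ := T.maxInjRadius_eq hα hβ hγ hsum hx hxπ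
  rw [he] at hmax ⊢
  exact ⟨hinj, hmax, hR, hzero, hsign⟩
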